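/- Let $\Gamma\neq 0$ be an additive subgroup of $\mathbb R$ and let $s\in\mathbb R$ with $2s\in\Gamma$. Let $\mathfrak L$ be the generalized super $W$-algebra $W(2,2)$, i.e. the Lie superalgebra over $\mathbb C$ with basis $\{L_p, I_p, G_r, H_r \mid p\in\Gamma,\ r\in s+\Gamma\}$, where $L_p,I_p$ are even and $G_r,H_r$ are odd, and whose non-vanishing super-brackets of basis elements are, up to super-skew-symmetry, $$[L_p,L_q]=(p-q)L_{p+q},\quad [L_p,I_q]=(p-q)I_{p+q},\quad [L_p,H_r]=(\tfrac p2-r)H_{p+r},$$ $$[G_r,G_t]=I_{r+t},\quad [L_p,G_r]=(\tfrac p2-r)G_{p+r},\quad [I_p,G_r]=(p-2r)H_{p+r}.$$ Write $[x]\in\mathbb Z/2$ for the parity of a homogeneous element. Formulas with parities are for homogeneous elements and extend linearly; tensor products carry the total parity. Put $\mathfrak V=\mathfrak L\otimes\mathfrak L$, with the adjoint diagonal action $x\circ(a\otimes b)=[x,a]\otimes b+(-1)^{[x][a]}a\otimes[x,b]$, let $\tau(x\otimes y)=(-1)^{[x][y]}y\otimes x$, and let $\xi=(1\otimes\tau)(\tau\otimes1)$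 on $\mathfrak L\otimes\mathfrak L\otimes\mathfrak L$. A linear map $d:\mathfrak L\to\mathfrak V$ is a derivation of parity $[d]$ if $d(\mathfrak L_i)\subset\mathfrak V_{i+[d]}$ and $d([x,y])=(-1)^{[d][x]}x\circ d(y)-(-1)^{[y]([d]+[x])}y\circ d(x)$. Let $\mathrm{Der}(\mathfrak L,\mathfrak V)=\mathrm{Der}_{\bar0}\oplus\mathrm{Der}_{\bar1}$ be the space of derivations. Let $\mathrm{Inn}(\mathfrak L,\mathfrak V)$ be the space of the inner ones $a_{\mathrm{Inn}}(x)=(-1)^{[a][x]}x\circ a$, $a\in\mathfrak V$. Let $H^1(\mathfrak L,\mathfrak V)$ be the first cohomology group, i.e. $1$-cocycles modulo the $1$-coboundaries $a_{\mathrm{Inn}}$. A Lie super-bialgebra structure on $\mathfrak L$ is a linear map $\Delta:\mathfrak L\to\mathfrak L\otimes\mathfrak L$ that is even, satisfies $\operatorname{Im}\Delta\subset\operatorname{Im}(1-\tau)$ and $(1+\xi+\xi^2)(1\otimes\Delta)\Delta=0$, and satisfies $\Delta([x,y])=x\circ\Delta(y)-(-1)^{[x][y]}y\circ\Delta(x)$.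 It is triangular coboundary if there is an even element $r=\sum_i a_i\otimes b_i\in\operatorname{Im}(1-\tau)$, with homogeneous $a_i,b_i$, such that $\Delta(x)=x\circ r$ for all $x\in\mathfrak L$ and $$c(r)=\sum_{i,j}\Big((-1)^{[a_j][b_i]}[a_i,a_j]\otimes b_i\otimes b_j+a_i\otimes[b_i,a_j]\otimes b_j+(-1)^{[a_j][b_i]}a_i\otimes a_j\otimes[b_i,b_j]\Big)=0.$$ Then: (1) $H^1(\mathfrak L,\mathfrak V)=0$; equivalently, $\mathrm{Der}(\mathfrak L,\mathfrak V)=\mathrm{Inn}(\mathfrak L,\mathfrak V)$. (2) Every Lie super-bialgebra structure on $\mathfrak L$ is triangular coboundary. -/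

import Mathlib

open scoped TensorProduct

noncomputable section

namespace SuperW

/-! ### Super vector spaces and the sign rule -/

/-- A super vector space `V = V_0 ⊕ V_1` over `ℂ`, given by the two complementary projections
`proj 0`, `proj 1` onto its even and its odd part. -/
class SuperSpace (V : Type*) [AddCommGroup V] [Module ℂ V] where
  proj : ZMod 2 → V →ₗ[ℂ] V
  proj_proj : ∀ i j x, proj i (proj j x) = if i = j then proj j x else 0
  proj_add : ∀ x, proj 0 x + proj 1 x = x

open SuperSpace (proj)

theorem sum_zmod_two {M : Type*} [AddCommMonoid M] (f : ZMod 2 → M) :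
    ∑ i : ZMod 2, f i = f 0 + f 1 := Fin.sum_univ_two f

/-- The sign `(-1)^{ij}` for `i, j ∈ ℤ/2`. -/
def sgn (i j : ZMod 2) : ℂ := (-1) ^ (i.val * j.val)

section General

variable {L V : Type*} [AddCommGroup L] [Module ℂ L] [SuperSpace L]
  [AddCommGroup V] [Module ℂ V] [SuperSpace V]

variable (V) in
/-- The homogeneous part `V_i` of a super vector space. -/
def part (i : ZMod 2) : Submodule ℂ V := LinearMap.range (proj (V := V) i)

/-- The parity on `L ⊗ V`: `(L ⊗ V)_k = ∑_{i + j = k} L_i ⊗ V_j`. -/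
instance : SuperSpace (L ⊗[ℂ] V) where
  proj k := ∑ i : ZMod 2, TensorProduct.map (proj i) (proj (k - i))
  proj_proj k l x := by
    induction x with
    | zero => simp
    | add x y hx hy => rw [map_add, map_add, hx, hy]; split_ifs <;> simp
    | tmul x y =>
      simp only [sum_zmod_two, LinearMap.add_apply, TensorProduct.map_tmul, map_add,
        SuperSpace.proj_proj]
      have h2 : ∀ k : ZMod 2, k = 0 ∨ k = 1 := by decide
      have h01 : (0 : ZMod 2) - 1 = 1 := rfl
      rcases h2 k with rfl | rfl <;> rcases h2 l with rfl | rfl <;> simp [h01]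
  proj_add x := by
    induction x with
    | zero => simp
    | add x y hx hy => rw [map_add, map_add, add_add_add_comm, hx, hy]
    | tmul x y =>
      simp only [sum_zmod_two, LinearMap.add_apply, TensorProduct.map_tmul, sub_zero, sub_self,
        show (0 : ZMod 2) - 1 = 1 from rfl]
      conv_rhs => rw [← SuperSpace.proj_add x, ← SuperSpace.proj_add y]
      simp only [TensorProduct.add_tmul, TensorProduct.tmul_add]
      abel

variable (L) in
/-- The super-twist `τ(x ⊗ y) = (-1)^{[x][y]} y ⊗ x`. -/
def superTwist : L ⊗[ℂ] L →ₗ[ℂ] L ⊗[ℂ] L :=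
  ∑ i : ZMod 2, ∑ j : ZMod 2,
    sgn i j • ((TensorProduct.comm ℂ L L).toLinearMap ∘ₗ TensorProduct.map (proj i) (proj j))

variable (L) in
/-- The super-cyclic map `ξ = (1 ⊗ τ)(τ ⊗ 1)` of `L ⊗ L ⊗ L`,
`x₁ ⊗ x₂ ⊗ x₃ ↦ (-1)^{[x₁]([x₂]+[x₃])} x₂ ⊗ x₃ ⊗ x₁`. -/
def superCyclic : L ⊗[ℂ] (L ⊗[ℂ] L) →ₗ[ℂ] L ⊗[ℂ] (L ⊗[ℂ] L) :=
  (superTwist L).lTensor L ∘ₗ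
    (TensorProduct.assoc ℂ L L L).toLinearMap ∘ₗ (superTwist L).rTensor L ∘ₗ
      (TensorProduct.assoc ℂ L L L).symm.toLinearMap

variable (L) in
/-- `1 + ξ + ξ²`. -/
def cyclicSum : L ⊗[ℂ] (L ⊗[ℂ] L) →ₗ[ℂ] L ⊗[ℂ] (L ⊗[ℂ] L) :=
  LinearMap.id + superCyclic L + superCyclic L ∘ₗ superCyclic L

/-! ### Lie superalgebras, Lie super-coalgebras, Lie super-bialgebras -/

/-- `(L, φ)` is a Lie superalgebra; `φ x y = [x, y]`. -/
structure IsLieSuperalgebra (φ : L →ₗ[ℂ] L →ₗ[ℂ] L) : Prop where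
  graded : ∀ i j : ZMod 2, ∀ x ∈ part L i, ∀ y ∈ part L j, φ x y ∈ part L (i + j)
  skew : LinearMap.ker (LinearMap.id - superTwist L) ≤ LinearMap.ker (TensorProduct.lift φ)
  jacobi : TensorProduct.lift φ ∘ₗ (TensorProduct.lift φ).lTensor L ∘ₗ cyclicSum L = 0

/-- `(L, Δ)` is a Lie super-coalgebra. -/
structure IsLieSupercoalgebra (Δ : L →ₗ[ℂ] L ⊗[ℂ] L) : Prop where
  graded : ∀ i : ZMod 2, ∀ x ∈ part L i, Δ x ∈ part (L ⊗[ℂ] L) i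
  skew : LinearMap.range Δ ≤ LinearMap.range (LinearMap.id - superTwist L)
  jacobi : cyclicSum L ∘ₗ Δ.lTensor L ∘ₗ Δ = 0

/-- The adjoint diagonal action of `L` on `L ⊗ L`:
`x ∘ (a ⊗ b) = [x, a] ⊗ b + (-1)^{[x][a]} a ⊗ [x, b]`. -/
def adjTensor (φ : L →ₗ[ℂ] L →ₗ[ℂ] L) : L →ₗ[ℂ] L ⊗[ℂ] L →ₗ[ℂ] L ⊗[ℂ] L :=
  LinearMap.rTensorHom L ∘ₗ φ +
    ∑ i : ZMod 2, ∑ j : ZMod 2,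
      sgn i j • (TensorProduct.mapBilinear (RingHom.id ℂ) L L L L (proj j) ∘ₗ φ ∘ₗ proj i)

/-- `(L, φ, Δ)` is a Lie super-bialgebra. -/
structure IsLieSuperbialgebra (φ : L →ₗ[ℂ] L →ₗ[ℂ] L) (Δ : L →ₗ[ℂ] L ⊗[ℂ] L) : Prop where
  algebra : IsLieSuperalgebra φ
  coalgebra : IsLieSupercoalgebra Δ
  compat : ∀ i j : ZMod 2, ∀ x ∈ part L i, ∀ y ∈ part L j,
    Δ (φ x y) = adjTensor φ x (Δ y) - sgn i j • adjTensor φ y (Δ x)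

/-! ### Derivations and first cohomology with coefficients in a module

The action of `L` on `V` is `ρ`, so that `ρ x v = x ∘ v`. -/

/-- The space of homogeneous derivations `L → V` of parity `p`. -/
def derPart (φ : L →ₗ[ℂ] L →ₗ[ℂ] L) (ρ : L →ₗ[ℂ] V →ₗ[ℂ] V) (p : ZMod 2) :
    Submodule ℂ (L →ₗ[ℂ] V) where
  carrier := {d | (∀ i : ZMod 2, ∀ x ∈ part L i, d x ∈ part V (i + p)) ∧
    ∀ i j : ZMod 2, ∀ x ∈ part L i, ∀ y ∈ part L j,
      d (φ x y) = sgn p i • ρ x (d y) - sgn j (p + i) • ρ y (d x)}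
  add_mem' := by
    rintro a b ⟨ha, ha'⟩ ⟨hb, hb'⟩
    refine ⟨fun i x hx => add_mem (ha i x hx) (hb i x hx), fun i j x hx y hy => ?_⟩
    simp only [LinearMap.add_apply, map_add, smul_add, ha' i j x hx y hy, hb' i j x hx y hy]
    abel
  zero_mem' := by simp
  smul_mem' := by
    rintro c a ⟨ha, ha'⟩
    refine ⟨fun i x hx => Submodule.smul_mem _ c (ha i x hx), fun i j x hx y hy => ?_⟩
    simp only [LinearMap.smul_apply, map_smul, ha' i j x hx y hy, smul_sub]
    rw [smul_comm c, smul_comm c]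

/-- `Der(L, V) = Der_0(L, V) ⊕ Der_1(L, V)`. -/
def der (φ : L →ₗ[ℂ] L →ₗ[ℂ] L) (ρ : L →ₗ[ℂ] V →ₗ[ℂ] V) : Submodule ℂ (L →ₗ[ℂ] V) :=
  derPart φ ρ 0 ⊔ derPart φ ρ 1

/-- The map `a ↦ a_Inn`, `a_Inn(x) = (-1)^{[a][x]} x ∘ a`. It is the differential from
`0`-cochains to `1`-cochains. -/
def innMap (ρ : L →ₗ[ℂ] V →ₗ[ℂ] V) : V →ₗ[ℂ] L →ₗ[ℂ] V :=
  ∑ p : ZMod 2, ∑ i : ZMod 2, sgn p i • (ρ.flip.compl₁₂ (proj p) (proj i))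

/-- `Inn_p(L, V)`, the inner derivations `a_Inn` with `a ∈ V_p`. -/
def innPart (ρ : L →ₗ[ℂ] V →ₗ[ℂ] V) (p : ZMod 2) : Submodule ℂ (L →ₗ[ℂ] V) :=
  (part V p).map (innMap ρ)

/-- `Inn(L, V) = Inn_0(L, V) ⊕ Inn_1(L, V)`. -/
def inn (ρ : L →ₗ[ℂ] V →ₗ[ℂ] V) : Submodule ℂ (L →ₗ[ℂ] V) :=
  innPart ρ 0 ⊔ innPart ρ 1

/-- The component of parity `p` of a linear map `f : L → V`. -/
def parityComponent (p : ZMod 2) : (L →ₗ[ℂ] V) →ₗ[ℂ] L →ₗ[ℂ] V where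
  toFun f := ∑ i : ZMod 2, proj (i + p) ∘ₗ f ∘ₗ proj i
  map_add' f g := by
    simp only [LinearMap.add_comp, LinearMap.comp_add, Finset.sum_add_distrib]
  map_smul' c f := by
    simp only [LinearMap.smul_comp, LinearMap.comp_smul, Finset.smul_sum, RingHom.id_apply]

/-- The differential from `1`-cochains to `2`-cochains of the Lie superalgebra complex: for `f`
of parity `p` and homogeneous `x`, `y`,
`(δf)(x, y) = (-1)^{p[x]} x ∘ f(y) - (-1)^{[y](p+[x])} y ∘ f(x) - f([x, y])`.
It is written with values in all bilinear maps `L × L → V`, which does not change its kernel. -/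
def cobdry (φ : L →ₗ[ℂ] L →ₗ[ℂ] L) (ρ : L →ₗ[ℂ] V →ₗ[ℂ] V) :
    (L →ₗ[ℂ] V) →ₗ[ℂ] L →ₗ[ℂ] L →ₗ[ℂ] V where
  toFun f := LinearMap.mk₂ ℂ
    (fun x y => ∑ p : ZMod 2, ∑ i : ZMod 2, ∑ j : ZMod 2,
        (sgn p i • ρ (proj i x) (parityComponent p f (proj j y)) -
          sgn j (p + i) • ρ (proj j y) (parityComponent p f (proj i x))) - f (φ x y))
    (fun x x' y => by
      simp only [sum_zmod_two, map_add, LinearMap.add_apply, smul_add]; abel)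
    (fun c x y => by
      simp only [map_smul, LinearMap.smul_apply, smul_sub, Finset.smul_sum,
        smul_comm c])
    (fun x y y' => by
      simp only [sum_zmod_two, map_add, LinearMap.add_apply, smul_add]; abel)
    (fun c x y => by
      simp only [map_smul, LinearMap.smul_apply, smul_sub, Finset.smul_sum,
        smul_comm c])
  map_add' f g := by
    refine LinearMap.ext₂ fun x y => ?_
    simp only [LinearMap.mk₂_apply, sum_zmod_two, map_add, LinearMap.add_apply, smul_add]
    abel
  map_smul' c f := by
    refine LinearMap.ext₂ fun x y => ?_
    simp only [LinearMap.mk₂_apply, map_smul, LinearMap.smul_apply, smul_sub, Finset.smul_sum,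
      smul_comm c, RingHom.id_apply]

/-- The first cohomology group `H¹(L, V)`: `1`-cocycles modulo `1`-coboundaries. -/
abbrev H1 (φ : L →ₗ[ℂ] L →ₗ[ℂ] L) (ρ : L →ₗ[ℂ] V →ₗ[ℂ] V) : Type _ :=
  LinearMap.ker (cobdry φ ρ) ⧸ (LinearMap.range (innMap ρ)).submoduleOf (LinearMap.ker (cobdry φ ρ))

/-! ### The classical Yang-Baxter equation and triangular coboundary structures -/

variable (L) in
/-- `(a ⊗ b) ⊗ (a' ⊗ b') ↦ (-1)^{[a'][b]} (a ⊗ a') ⊗ (b ⊗ b')`. -/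
def superMiddle : (L ⊗[ℂ] L) ⊗[ℂ] (L ⊗[ℂ] L) →ₗ[ℂ] (L ⊗[ℂ] L) ⊗[ℂ] (L ⊗[ℂ] L) :=
  (TensorProduct.tensorTensorTensorComm ℂ L L L L).toLinearMap ∘ₗ
    ∑ i : ZMod 2, ∑ j : ZMod 2,
      sgn i j • TensorProduct.map ((proj i).lTensor L) ((proj j).rTensor L)

/-- For `r = ∑ a_i ⊗ b_i`, the element
`[r¹², r¹³] = ∑_{i,j} (-1)^{[a_j][b_i]} [a_i, a_j] ⊗ b_i ⊗ b_j`. -/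
def bracket1213 (φ : L →ₗ[ℂ] L →ₗ[ℂ] L) (r : L ⊗[ℂ] L) : L ⊗[ℂ] (L ⊗[ℂ] L) :=
  (TensorProduct.lift φ).rTensor (L ⊗[ℂ] L) (superMiddle L (r ⊗ₜ r))

/-- For `r = ∑ a_i ⊗ b_i`, the element `[r¹², r²³] = ∑_{i,j} a_i ⊗ [b_i, a_j] ⊗ b_j`. -/
def bracket1223 (φ : L →ₗ[ℂ] L →ₗ[ℂ] L) (r : L ⊗[ℂ] L) : L ⊗[ℂ] (L ⊗[ℂ] L) :=
  (((TensorProduct.lift φ).rTensor L ∘ₗ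
      (TensorProduct.assoc ℂ L L L).symm.toLinearMap).lTensor L)
    (TensorProduct.assoc ℂ L L (L ⊗[ℂ] L) (r ⊗ₜ r))

/-- For `r = ∑ a_i ⊗ b_i`, the element
`[r¹³, r²³] = ∑_{i,j} (-1)^{[a_j][b_i]} a_i ⊗ a_j ⊗ [b_i, b_j]`. -/
def bracket1323 (φ : L →ₗ[ℂ] L →ₗ[ℂ] L) (r : L ⊗[ℂ] L) : L ⊗[ℂ] (L ⊗[ℂ] L) :=
  TensorProduct.assoc ℂ L L L
    ((TensorProduct.lift φ).lTensor (L ⊗[ℂ] L) (superMiddle L (r ⊗ₜ r)))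

/-- `c(r) = [r¹², r¹³] + [r¹², r²³] + [r¹³, r²³]`. -/
def cybe (φ : L →ₗ[ℂ] L →ₗ[ℂ] L) (r : L ⊗[ℂ] L) : L ⊗[ℂ] (L ⊗[ℂ] L) :=
  bracket1213 φ r + bracket1223 φ r + bracket1323 φ r

/-- The Lie super-bialgebra `(L, φ, Δ)` is triangular coboundary: there is an even
`r ∈ Im(1 - τ)` with `Δ = Δ_r`, where `Δ_r(x) = (-1)^{[r][x]} x ∘ r`, and `c(r) = 0`. -/
def IsTriangularCoboundary (φ : L →ₗ[ℂ] L →ₗ[ℂ] L) (Δ : L →ₗ[ℂ] L ⊗[ℂ] L) : Prop :=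
  IsLieSuperbialgebra φ Δ ∧
    ∃ r ∈ LinearMap.range (LinearMap.id - superTwist L), r ∈ part (L ⊗[ℂ] L) 0 ∧
      Δ = innMap (adjTensor φ) r ∧ cybe φ r = 0

end General

/-! ### The generalized super `W`-algebra `W(2,2)` -/

/-- The labels of the basis `L_p, I_p (p ∈ Γ)`, `G_r, H_r (r ∈ s + Γ)`. -/
inductive Idx (Γ : AddSubgroup ℝ) (s : ℝ) : Type
  | L (p : ℝ) (hp : p ∈ Γ) : Idx Γ s
  | I (p : ℝ) (hp : p ∈ Γ) : Idx Γ s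
  | G (r : ℝ) (hr : r - s ∈ Γ) : Idx Γ s
  | H (r : ℝ) (hr : r - s ∈ Γ) : Idx Γ s

/-- `L_p`, `I_p` are even, `G_r`, `H_r` are odd. -/
def Idx.parity {Γ : AddSubgroup ℝ} {s : ℝ} : Idx Γ s → ZMod 2
  | .L _ _ => 0
  | .I _ _ => 0
  | .G _ _ => 1
  | .H _ _ => 1

/-- The underlying space of the algebra, with basis indexed by `Idx Γ s`. -/
abbrev WAlg (Γ : AddSubgroup ℝ) (s : ℝ) : Type := Idx Γ s →₀ ℂ

instance (Γ : AddSubgroup ℝ) (s : ℝ) : SuperSpace (WAlg Γ s) where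
  proj i := Finsupp.lsum ℂ fun a => if a.parity = i then Finsupp.lsingle a else 0
  proj_proj i j x := by
    induction x using Finsupp.induction_linear with
    | zero => simp
    | add x y hx hy => rw [map_add, map_add, hx, hy]; split_ifs <;> simp
    | single a c =>
      by_cases h : a.parity = j
      · by_cases h' : i = j
        · simp [h, h']
        · simp [h, h', Ne.symm h']
      · simp [h]
  proj_add x := by
    induction x using Finsupp.induction_linear with
    | zero => simp
    | add x y hx hy => rw [map_add, map_add, add_add_add_comm, hx, hy]
    | single a c => cases a <;> simp [Idx.parity]

variable {Γ : AddSubgroup ℝ} {s : ℝ}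

theorem mem_add_left {p r : ℝ} (hp : p ∈ Γ) (hr : r - s ∈ Γ) : p + r - s ∈ Γ := by
  rw [add_sub_assoc]; exact Γ.add_mem hp hr

theorem mem_add_odd (hs : 2 * s ∈ Γ) {r t : ℝ} (hr : r - s ∈ Γ) (ht : t - s ∈ Γ) : r + t ∈ Γ := by
  have h := Γ.add_mem (Γ.add_mem hr ht) hs
  rwa [show r - s + (t - s) + 2 * s = r + t by ring] at h

open Idx in
/-- The super-brackets of basis elements; the brackets not listed in the definition of the
algebra are obtained by super-skew-symmetry or vanish. -/
def basisBracket (hs : 2 * s ∈ Γ) : Idx Γ s → Idx Γ s → WAlg Γ s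
  | L p hp, L q hq => Finsupp.single (L (p + q) (Γ.add_mem hp hq)) ((p : ℂ) - q)
  | L p hp, I q hq => Finsupp.single (I (p + q) (Γ.add_mem hp hq)) ((p : ℂ) - q)
  | I q hq, L p hp => -Finsupp.single (I (p + q) (Γ.add_mem hp hq)) ((p : ℂ) - q)
  | L p hp, H r hr => Finsupp.single (H (p + r) (mem_add_left hp hr)) ((p : ℂ) / 2 - r)
  | H r hr, L p hp => -Finsupp.single (H (p + r) (mem_add_left hp hr)) ((p : ℂ) / 2 - r)
  | G r hr, G t ht => Finsupp.single (I (r + t) (mem_add_odd hs hr ht)) 1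
  | L p hp, G r hr => Finsupp.single (G (p + r) (mem_add_left hp hr)) ((p : ℂ) / 2 - r)
  | G r hr, L p hp => -Finsupp.single (G (p + r) (mem_add_left hp hr)) ((p : ℂ) / 2 - r)
  | I p hp, G r hr => Finsupp.single (H (p + r) (mem_add_left hp hr)) ((p : ℂ) - 2 * r)
  | G r hr, I p hp => -Finsupp.single (H (p + r) (mem_add_left hp hr)) ((p : ℂ) - 2 * r)
  | I _ _, I _ _ => 0
  | I _ _, H _ _ => 0
  | H _ _, I _ _ => 0
  | G _ _, H _ _ => 0
  | H _ _, G _ _ => 0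
  | H _ _, H _ _ => 0

/-- The super-bracket of the generalized super `W`-algebra `W(2,2)`. -/
def bracket (hs : 2 * s ∈ Γ) : WAlg Γ s →ₗ[ℂ] WAlg Γ s →ₗ[ℂ] WAlg Γ s :=
  Finsupp.linearCombination ℂ fun a => Finsupp.linearCombination ℂ fun b => basisBracket hs a b

end SuperW

end

/-!
Everything reduces to the even elements `L_k`. Write `w` for the number attached to each type of
basis vector (`1` for `L`, `I` and `1/2` for `G`, `H`), so that
`[L_k, x] = (k w - deg x) x'`, where `x'` has the type of `x` and the degree `deg x + k`. On a
tensor product with finitely many nonzero coordinates, `L_k` with `k` large moves the support of a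
factor away from everything else, and the coefficients `k w - deg x` do not vanish. Hence an
element of `WAlg ⊗ M` killed by `L_k` is zero (`eq_zero_of_large`), and so is an eigenvector of
`L_{-k} L_k` in `WAlg ⊗ WAlg` (`eq_zero_of_act_act`).

*Cocycles are coboundaries* (`cocycles_le_range_innMap`). Let `f` be a cocycle with values in
`WAlg ⊗ WAlg`. As `L_0` acts by minus the degree, subtracting an inner derivation leaves in `f(L_0)`
only the part of degree `0`; this part is invariant, hence zero, and `f` then preserves
degrees. Next fix `p > 0` in `Γ`. The values `f(L_{mp})`, `m ≥ 1`, are generated by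
`f(L_p)` and `f(L_{2p})`, so the degrees in both factors are bounded below independently of `m`, and
they are bounded above for `m ≤ -1` (`exists_uniform_bound`). Take `n = m p` much larger than these
bounds. In units of `n` the values at `L_n`, `L_{-n}`, `L_{2n}` have at most two, two and three
coordinates along each family of pairs of basis vectors, and the cocycle identities for
`(n, -n)` and `(-n, 2n)` form a small linear system. Its solutions are exactly those of inner
derivations (`generator_system`), so after subtracting one, `f` vanishes on `L_n` and `L_{2n}`.
Then `f` vanishes on `L_{jn}` for all `j ≠ 0` and commutes with their action, so every value
`f(x)` on a basis vector is an eigenvector of `L_{-k} L_k` for large `k`, and `f = 0`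
(`cocycle_eq_zero_of_generators`).

*Bialgebra structures are triangular* (`IsLieSuperbialgebra.isTriangularCoboundary`). The cobracket
is an even derivation, hence `Δ(x) = x ∘ r` with `r` even. Skew-symmetry of `Δ` makes `r + τ r`
invariant, hence zero, and for such `r` the co-Jacobi expression `(1 + ξ + ξ²)(1 ⊗ Δ)Δ(x)`
equals `x ∘ c(r)` for even `x` (`coJacobi_eq_tripleAct_cybe`). Therefore `c(r)` is invariant
under the `L_k`, hence zero.
-/

open scoped TensorProduct

noncomputable section

namespace SuperW

open SuperSpace (proj)

variable {Γ : AddSubgroup ℝ} {s : ℝ}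

/-! ### The action of the elements `L_k` on the basis -/

namespace Idx

/-- The degree of a basis vector: `p` for `L_p`, `I_p` and `r` for `G_r`, `H_r`. -/
def deg : Idx Γ s → ℝ
  | .L p _ => p
  | .I p _ => p
  | .G r _ => r
  | .H r _ => r

/-- The number `w` with `[L_k, x] = (k w - deg x) x'` on the basis vectors `x` of a given type:
`1` on the `L_p`, `I_p` and `1/2` on the `G_r`, `H_r`. -/
def wt : Idx Γ s → ℝ
  | .L _ _ => 1
  | .I _ _ => 1
  | .G _ _ => 1 / 2
  | .H _ _ => 1 / 2

/-- The label of the same type whose degree is larger by `k ∈ Γ`. -/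
def shift (k : Γ) : Idx Γ s → Idx Γ s
  | .L p hp => .L (k + p) (Γ.add_mem k.2 hp)
  | .I p hp => .I (k + p) (Γ.add_mem k.2 hp)
  | .G r hr => .G (k + r) (mem_add_left k.2 hr)
  | .H r hr => .H (k + r) (mem_add_left k.2 hr)

@[simp] theorem deg_shift (k : Γ) (i : Idx Γ s) : (shift k i).deg = i.deg + k := by
  cases i <;> simp [shift, deg, add_comm]

@[simp] theorem wt_shift (k : Γ) (i : Idx Γ s) : (shift k i).wt = i.wt := by
  cases i <;> rfl

theorem shift_shift (k l : Γ) (i : Idx Γ s) : shift k (shift l i) = shift (k + l) i := by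
  cases i <;> simp [shift, add_assoc]

@[simp] theorem shift_zero (i : Idx Γ s) : shift 0 i = i := by
  cases i <;> simp [shift]

@[simp] theorem shift_neg_shift (k : Γ) (i : Idx Γ s) : shift (-k) (shift k i) = i := by
  simp [shift_shift]

@[simp] theorem shift_shift_neg (k : Γ) (i : Idx Γ s) : shift k (shift (-k) i) = i := by
  simp [shift_shift]

theorem wt_eq (i : Idx Γ s) : i.wt = 1 ∨ i.wt = 1 / 2 := by
  cases i <;> simp [wt]

theorem half_le_wt (i : Idx Γ s) : 1 / 2 ≤ i.wt := by
  rcases i.wt_eq with h | h <;> norm_num [h]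

/-- The coefficient in `[L_k, x_i] = (k w_i - deg i) x_{i + k}`. -/
def coeff (k : Γ) (i : Idx Γ s) : ℂ := ((k * i.wt - i.deg : ℝ) : ℂ)

end Idx

/-- The basis vector `L_k`. -/
def basisL (s : ℝ) (k : Γ) : WAlg Γ s := Finsupp.single (.L k k.2) 1

theorem bracket_single (hs : 2 * s ∈ Γ) (i j : Idx Γ s) (c d : ℂ) :
    bracket hs (Finsupp.single i c) (Finsupp.single j d) = (c * d) • basisBracket hs i j := by
  simp [bracket, mul_smul]

theorem bracket_basisL (hs : 2 * s ∈ Γ) (k : Γ) (i : Idx Γ s) (c : ℂ) :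
    bracket hs (basisL s k) (Finsupp.single i c) =
      Finsupp.single (i.shift k) (c * i.coeff k) := by
  rw [basisL, bracket_single]
  cases i <;> simp only [basisBracket, Finsupp.smul_single, smul_eq_mul, one_mul, Idx.shift] <;>
    congr 2 <;> simp [Idx.coeff, Idx.wt, Idx.deg, div_eq_mul_inv]

theorem bracket_basisL_apply (hs : 2 * s ∈ Γ) (k : Γ) (x : WAlg Γ s) (i : Idx Γ s) :
    bracket hs (basisL s k) x i = (i.shift (-k)).coeff k * x (i.shift (-k)) := by
  induction x using Finsupp.induction_linear with
  | zero => simp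
  | add x y hx hy => simp [hx, hy, mul_add]
  | single j c =>
    rw [bracket_basisL]
    by_cases h : j.shift k = i
    · subst h; simp [mul_comm]
    · rw [Finsupp.single_eq_of_ne (Ne.symm h), Finsupp.single_eq_of_ne, mul_zero]
      rintro rfl; simp at h

theorem bracket_basisL_basisL (hs : 2 * s ∈ Γ) (k l : Γ) :
    bracket hs (basisL s k) (basisL s l) = ((k : ℂ) - l) • basisL s (k + l) := by
  rw [basisL, basisL, bracket_single]
  simp [basisBracket, basisL]

/-! ### Coordinates on tensor products and injectivity for large degree -/

section Coordinates

variable {M : Type*} [AddCommGroup M] [Module ℂ M]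

open Classical in
/-- The component in `M` of an element of `WAlg ⊗ M` along a basis vector of `WAlg`. -/
def component (i : Idx Γ s) : WAlg Γ s ⊗[ℂ] M →ₗ[ℂ] M :=
  Finsupp.lapply i ∘ₗ (TensorProduct.finsuppScalarLeft ℂ M (Idx Γ s)).toLinearMap

open Classical in
@[simp] theorem component_tmul (i : Idx Γ s) (x : WAlg Γ s) (m : M) :
    component i (x ⊗ₜ[ℂ] m) = x i • m := by
  simp [component, TensorProduct.finsuppScalarLeft_apply_tmul_apply]

open Classical in
theorem component_ext {v w : WAlg Γ s ⊗[ℂ] M} (h : ∀ i, component i v = component i w) :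
    v = w :=
  (TensorProduct.finsuppScalarLeft ℂ M (Idx Γ s)).injective (Finsupp.ext h)

open Classical in
theorem finite_component_ne_zero (v : WAlg Γ s ⊗[ℂ] M) : {i | component i v ≠ 0}.Finite :=
  (TensorProduct.finsuppScalarLeft ℂ M (Idx Γ s) v).hasFiniteSupport

theorem component_rTensor (hs : 2 * s ∈ Γ) (k : Γ) (i : Idx Γ s) (v : WAlg Γ s ⊗[ℂ] M) :
    component i ((bracket hs (basisL s k)).rTensor M v) =
      (i.shift (-k)).coeff k • component (i.shift (-k)) v := by
  induction v with
  | zero => simp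
  | add v w hv hw => simp [hv, hw]
  | tmul x m => simp [bracket_basisL_apply, mul_smul]

theorem component_lTensor (T : M →ₗ[ℂ] M) (i : Idx Γ s) (v : WAlg Γ s ⊗[ℂ] M) :
    component i (T.lTensor (WAlg Γ s) v) = T (component i v) := by
  induction v with
  | zero => simp
  | add v w hv hw => simp [hv, hw]
  | tmul x m => simp

theorem exists_bound_of_finite {S : Set (Idx Γ s)} (hS : S.Finite) :
    ∃ B : ℝ, ∀ i ∈ S, |i.deg| ≤ B := by
  obtain ⟨B, hB⟩ := (hS.image fun i => |i.deg|).bddAbove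
  exact ⟨B, fun i hi => hB ⟨i, hi, rfl⟩⟩

theorem Idx.coeff_ne_zero {i : Idx Γ s} {k : Γ} {B : ℝ} (hi : |i.deg| ≤ B)
    (hk : 2 * B < |(k : ℝ)|) : i.coeff k ≠ 0 := by
  have hw := i.half_le_wt
  rw [Idx.coeff, Complex.ofReal_ne_zero]
  intro h
  have h1 : |(k : ℝ)| * i.wt = |i.deg| := by
    rw [← abs_of_nonneg (by linarith : 0 ≤ i.wt), ← abs_mul]; congr 1; linarith
  nlinarith [abs_nonneg (k : ℝ)]

/-- For `k` large enough, `L_k ⊗ 1 + 1 ⊗ T` does not kill a nonzero `v ∈ WAlg ⊗ M`, whatever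
`T` is: the degrees in the left factor of the two summands are disjoint. -/
theorem eq_zero_of_large (hs : 2 * s ∈ Γ) (v : WAlg Γ s ⊗[ℂ] M) :
    ∃ K : ℝ, ∀ k : Γ, K < k → ∀ T : M →ₗ[ℂ] M,
      (bracket hs (basisL s k)).rTensor M v + T.lTensor (WAlg Γ s) v = 0 → v = 0 := by
  obtain ⟨B, hB⟩ := exists_bound_of_finite (finite_component_ne_zero v)
  refine ⟨2 * B, fun k hk T h => component_ext fun i => ?_⟩
  rw [map_zero]
  by_contra hi
  have hiB := hB i hi
  have hB0 : 0 ≤ B := (abs_nonneg _).trans hiB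
  have h0 : component (i.shift k) v = 0 := by
    by_contra hne
    have := hB _ hne
    rw [Idx.deg_shift] at this
    linarith [abs_le.1 hiB, abs_le.1 this]
  have := congrArg (component (i.shift k)) h
  rw [map_add, component_rTensor, component_lTensor, h0, map_zero, add_zero, map_zero,
    Idx.shift_neg_shift] at this
  exact (smul_ne_zero (Idx.coeff_ne_zero hiB (hk.trans_le (le_abs_self _))) hi) this

/-- The coordinate of an element of `WAlg ⊗ WAlg` along a pair of basis vectors. -/
def coord (i j : Idx Γ s) : WAlg Γ s ⊗[ℂ] WAlg Γ s →ₗ[ℂ] ℂ :=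
  Finsupp.lapply j ∘ₗ component i

theorem coord_apply (i j : Idx Γ s) (v : WAlg Γ s ⊗[ℂ] WAlg Γ s) :
    coord i j v = component i v j := rfl

theorem coord_ext {v w : WAlg Γ s ⊗[ℂ] WAlg Γ s} (h : ∀ i j, coord i j v = coord i j w) :
    v = w :=
  component_ext fun i => Finsupp.ext (h i)

theorem exists_coord_bound (v : WAlg Γ s ⊗[ℂ] WAlg Γ s) :
    ∃ B : ℝ, ∀ i j, coord i j v ≠ 0 → |i.deg| ≤ B ∧ |j.deg| ≤ B := by
  have h1 := finite_component_ne_zero v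
  obtain ⟨B, hB⟩ := exists_bound_of_finite h1
  obtain ⟨C, hC⟩ := exists_bound_of_finite
    (h1.biUnion fun i _ => (component i v).hasFiniteSupport)
  refine ⟨max B C, fun i j hij => ?_⟩
  have hi : component i v ≠ 0 := fun h => hij (by simp [coord_apply, h])
  exact ⟨(hB i hi).trans (le_max_left _ _),
    (hC j (Set.mem_biUnion hi (Function.mem_support.2 hij))).trans (le_max_right _ _)⟩

theorem finite_coord_ne_zero (v : WAlg Γ s ⊗[ℂ] WAlg Γ s) :
    {p : Idx Γ s × Idx Γ s | coord p.1 p.2 v ≠ 0}.Finite := by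
  have h1 := finite_component_ne_zero v
  refine (h1.prod (h1.biUnion fun i _ => (component i v).hasFiniteSupport)).subset ?_
  rintro ⟨i, j⟩ hij
  have hi : component i v ≠ 0 := fun h => hij (by simp [coord_apply, h])
  exact ⟨hi, Set.mem_biUnion hi (Function.mem_support.2 hij)⟩

/-- Every finitely supported family is the family of coordinates of a tensor. -/
theorem exists_coord_eq (c : Idx Γ s → Idx Γ s → ℂ)
    (hc : {p : Idx Γ s × Idx Γ s | c p.1 p.2 ≠ 0}.Finite) :
    ∃ v : WAlg Γ s ⊗[ℂ] WAlg Γ s, ∀ i j, coord i j v = c i j := by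
  classical
  refine ⟨∑ p ∈ hc.toFinset, c p.1 p.2 •
    (Finsupp.single p.1 (1 : ℂ) ⊗ₜ[ℂ] Finsupp.single p.2 (1 : ℂ)), fun i j => ?_⟩
  rw [map_sum, Finset.sum_eq_single (i, j)]
  · simp [coord_apply]
  · rintro ⟨i', j'⟩ - hne
    by_cases h : i' = i
    · have : j' ≠ j := fun h' => hne (by rw [h, h'])
      simp [coord_apply, Finsupp.single_eq_of_ne this.symm]
    · simp [coord_apply, Finsupp.single_eq_of_ne (Ne.symm h)]
  · intro h
    simp_all

end Coordinates

/-! ### The action of `L_k` on `WAlg ⊗ WAlg` -/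

theorem sgn_zero_left (j : ZMod 2) : sgn 0 j = 1 := by simp [sgn]

theorem sgn_zero_right (i : ZMod 2) : sgn i 0 = 1 := by simp [sgn]

theorem sgn_one_one : sgn 1 1 = -1 := by simp [sgn, ZMod.val_one]

theorem zmod_two_cases (i : ZMod 2) : i = 0 ∨ i = 1 := by revert i; decide

section Homogeneous

variable {L V : Type*} [AddCommGroup L] [Module ℂ L] [SuperSpace L]
  [AddCommGroup V] [Module ℂ V] [SuperSpace V]

theorem proj_of_mem {i : ZMod 2} {x : V} (hx : x ∈ part V i) (j : ZMod 2) :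
    proj j x = if j = i then x else 0 := by
  obtain ⟨y, rfl⟩ := hx
  exact SuperSpace.proj_proj j i y

theorem mem_part_iff {i : ZMod 2} {x : V} : x ∈ part V i ↔ proj i x = x :=
  ⟨fun h => by simp [proj_of_mem h], fun h => ⟨x, h⟩⟩

theorem proj_mem (i : ZMod 2) (x : V) : proj i x ∈ part V i := ⟨x, rfl⟩

theorem adjTensor_of_mem (φ : L →ₗ[ℂ] L →ₗ[ℂ] L) {i : ZMod 2} {x : L} (hx : x ∈ part L i)
    (a b : L) : adjTensor φ x (a ⊗ₜ[ℂ] b) = φ x a ⊗ₜ b +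
      ∑ j : ZMod 2, sgn i j • proj j a ⊗ₜ[ℂ] φ x b := by
  simp only [adjTensor, LinearMap.add_apply, sum_zmod_two]
  simp only [LinearMap.comp_apply, LinearMap.coe_rTensorHom, LinearMap.rTensor_tmul,
    LinearMap.smul_apply, proj_of_mem hx]
  rcases zmod_two_cases i with rfl | rfl <;> simp [sgn_zero_left, TensorProduct.smul_tmul']

theorem adjTensor_tmul (φ : L →ₗ[ℂ] L →ₗ[ℂ] L) {i j : ZMod 2} {x a : L} (hx : x ∈ part L i)
    (ha : a ∈ part L j) (b : L) :
    adjTensor φ x (a ⊗ₜ[ℂ] b) = φ x a ⊗ₜ b + sgn i j • a ⊗ₜ[ℂ] φ x b := by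
  rw [adjTensor_of_mem φ hx, sum_zmod_two, proj_of_mem ha, proj_of_mem ha]
  rcases zmod_two_cases j with rfl | rfl <;> simp

theorem adjTensor_even (φ : L →ₗ[ℂ] L →ₗ[ℂ] L) {x : L} (hx : x ∈ part L 0) :
    adjTensor φ x = (φ x).rTensor L + (φ x).lTensor L := by
  refine TensorProduct.ext' fun a b => ?_
  rw [adjTensor_of_mem φ hx, sum_zmod_two, sgn_zero_left, sgn_zero_left, one_smul, one_smul,
    ← TensorProduct.add_tmul, SuperSpace.proj_add]
  simp

end Homogeneous

theorem proj_single (i : ZMod 2) (a : Idx Γ s) (c : ℂ) :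
    proj i (Finsupp.single a c : WAlg Γ s) = if a.parity = i then Finsupp.single a c else 0 := by
  change (Finsupp.lsum ℂ _ : _ →ₗ[ℂ] _) (Finsupp.single a c) = _
  rw [Finsupp.lsum_single]
  split_ifs <;> simp

theorem single_mem_part (a : Idx Γ s) (c : ℂ) :
    (Finsupp.single a c : WAlg Γ s) ∈ part (WAlg Γ s) a.parity :=
  mem_part_iff.2 (by simp [proj_single])

theorem basisL_mem (k : Γ) : basisL s k ∈ part (WAlg Γ s) 0 :=
  single_mem_part (Idx.L (k : ℝ) k.2) 1

/-- The action of `L_k` on `WAlg ⊗ WAlg`. -/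
def act (hs : 2 * s ∈ Γ) (k : Γ) :
    WAlg Γ s ⊗[ℂ] WAlg Γ s →ₗ[ℂ] WAlg Γ s ⊗[ℂ] WAlg Γ s :=
  adjTensor (bracket hs) (basisL s k)

theorem coord_act (hs : 2 * s ∈ Γ) (k : Γ) (v : WAlg Γ s ⊗[ℂ] WAlg Γ s) (i j : Idx Γ s) :
    coord i j (act hs k v) =
      (i.shift (-k)).coeff k * coord (i.shift (-k)) j v +
        (j.shift (-k)).coeff k * coord i (j.shift (-k)) v := by
  simp only [act, adjTensor_even _ (basisL_mem k), LinearMap.add_apply, map_add, coord_apply,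
    component_rTensor, component_lTensor, bracket_basisL_apply,
    Finsupp.smul_apply, smul_eq_mul]

theorem eq_zero_of_act_eq_zero (hs : 2 * s ∈ Γ) (v : WAlg Γ s ⊗[ℂ] WAlg Γ s) :
    ∃ K : ℝ, ∀ k : Γ, K < k → act hs k v = 0 → v = 0 := by
  obtain ⟨K, hK⟩ := eq_zero_of_large hs v
  refine ⟨K, fun k hk h => hK k hk (bracket hs (basisL s k)) ?_⟩
  rwa [act, adjTensor_even _ (basisL_mem k)] at h

/-- A tensor that is an eigenvector of `L_{-k} L_k` for a large `k` vanishes: the part of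
`L_{-k} L_k v` in which the left degrees went up by `k` and the right ones down by `k` is
disjoint from everything else. -/
theorem eq_zero_of_act_act (hs : 2 * s ∈ Γ) (v : WAlg Γ s ⊗[ℂ] WAlg Γ s) :
    ∃ K : ℝ, ∀ k : Γ, K < k → ∀ c : ℂ,
      act hs (-k) (act hs k v) = c • v → v = 0 := by
  obtain ⟨B, hB⟩ := exists_coord_bound v
  refine ⟨2 * B, fun k hk c h => coord_ext fun i j => ?_⟩
  rw [map_zero]
  by_contra hij
  obtain ⟨hi, hj⟩ := hB i j hij
  have hB0 : 0 ≤ B := (abs_nonneg _).trans hi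
  have hk' : 2 * B < |(k : ℝ)| := hk.trans_le (le_abs_self _)
  have h0 : ∀ (i' j' : Idx Γ s), i.deg + k ≤ i'.deg → coord i' j' v = 0 := by
    intro i' j' hd
    by_contra hne
    linarith [abs_le.1 hi, abs_le.1 (hB _ _ hne).1]
  have := congrArg (coord (i.shift k) (j.shift (-k))) h
  simp only [coord_act, map_smul, neg_neg, Idx.shift_shift_neg, Idx.shift_neg_shift] at this
  rw [h0 (i.shift k) (j.shift (-k)) (by simp),
    h0 ((i.shift k).shift k) _ (by simp; linarith)] at this
  have hz := mul_ne_zero (Idx.coeff_ne_zero (k := -k) hj (by simpa using hk'))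
    (mul_ne_zero (Idx.coeff_ne_zero hi hk') hij)
  simp at this
  simp_all

/-! ### Derivations, inner derivations and cocycles -/

section Homogeneous

variable {L V : Type*} [AddCommGroup L] [Module ℂ L] [SuperSpace L]
  [AddCommGroup V] [Module ℂ V] [SuperSpace V]

theorem sgn_add_left (i j k : ZMod 2) : sgn (i + j) k = sgn i k * sgn j k := by
  rcases zmod_two_cases i with rfl | rfl <;> rcases zmod_two_cases j with rfl | rfl <;>
    rcases zmod_two_cases k with rfl | rfl <;>
    simp [sgn_zero_left, sgn_zero_right, sgn_one_one, show (1 + 1 : ZMod 2) = 0 from rfl]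

theorem sgn_comm (i j : ZMod 2) : sgn i j = sgn j i := by simp [sgn, mul_comm]

theorem sgn_add_right (i j k : ZMod 2) : sgn i (j + k) = sgn i j * sgn i k := by
  rw [sgn_comm, sgn_add_left, sgn_comm j, sgn_comm k]

theorem sgn_mul_self (i j : ZMod 2) : sgn i j * sgn i j = 1 := by
  rcases zmod_two_cases i with rfl | rfl <;> rcases zmod_two_cases j with rfl | rfl <;>
    simp [sgn_zero_left, sgn_zero_right, sgn_one_one]

theorem parityComponent_apply_of_mem (f : L →ₗ[ℂ] V) (p : ZMod 2) {i : ZMod 2} {x : L}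
    (hx : x ∈ part L i) : parityComponent p f x = proj (i + p) (f x) := by
  simp only [parityComponent, LinearMap.coe_mk, AddHom.coe_mk, sum_zmod_two,
    LinearMap.add_apply, LinearMap.comp_apply, proj_of_mem hx]
  rcases zmod_two_cases i with rfl | rfl <;> simp

theorem cobdry_apply_of_mem (φ : L →ₗ[ℂ] L →ₗ[ℂ] L) (ρ : L →ₗ[ℂ] V →ₗ[ℂ] V) (f : L →ₗ[ℂ] V)
    {i j : ZMod 2} {x y : L} (hx : x ∈ part L i) (hy : y ∈ part L j) :
    cobdry φ ρ f x y = ∑ p : ZMod 2, (sgn p i • ρ x (proj (j + p) (f y)) -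
      sgn j (p + i) • ρ y (proj (i + p) (f x))) - f (φ x y) := by
  simp only [cobdry, LinearMap.coe_mk, AddHom.coe_mk, LinearMap.mk₂_apply, proj_of_mem hx,
    proj_of_mem hy, sum_zmod_two]
  rcases zmod_two_cases i with rfl | rfl <;> rcases zmod_two_cases j with rfl | rfl <;>
    simp [parityComponent_apply_of_mem f _ hx, parityComponent_apply_of_mem f _ hy]

/-- A linear map which agrees with another one on homogeneous vectors is equal to it. -/
theorem linearMap_ext_part {W : Type*} [AddCommGroup W] [Module ℂ W] {f g : L →ₗ[ℂ] W}
    (h : ∀ i, ∀ x ∈ part L i, f x = g x) : f = g := by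
  ext x
  rw [← SuperSpace.proj_add x, map_add, map_add, h _ _ (proj_mem 0 x), h _ _ (proj_mem 1 x)]

theorem proj_sum_shift (i : ZMod 2) (v : V) : proj (i + 0) v + proj (i + 1) v = v := by
  rcases zmod_two_cases i with rfl | rfl
  · simp [SuperSpace.proj_add]
  · rw [add_comm, add_zero]; exact SuperSpace.proj_add v

theorem cocycle_even_even {φ : L →ₗ[ℂ] L →ₗ[ℂ] L} {ρ : L →ₗ[ℂ] V →ₗ[ℂ] V} {f : L →ₗ[ℂ] V}
    (hf : f ∈ LinearMap.ker (cobdry φ ρ)) {x y : L} (hx : x ∈ part L 0) (hy : y ∈ part L 0) :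
    f (φ x y) = ρ x (f y) - ρ y (f x) := by
  have h := cobdry_apply_of_mem φ ρ f hx hy
  rw [LinearMap.mem_ker.1 hf, LinearMap.zero_apply, LinearMap.zero_apply, eq_comm,
    sub_eq_zero] at h
  rw [← h, sum_zmod_two]
  conv_rhs => rw [← proj_sum_shift 0 (f y), ← proj_sum_shift 0 (f x)]
  simp only [sgn_zero_left, sgn_zero_right, one_smul, map_add]
  abel

/-- A cocycle that vanishes on an even element `x` commutes with the action of `x`. -/
theorem cocycle_of_eq_zero {φ : L →ₗ[ℂ] L →ₗ[ℂ] L} {ρ : L →ₗ[ℂ] V →ₗ[ℂ] V} {f : L →ₗ[ℂ] V}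
    (hf : f ∈ LinearMap.ker (cobdry φ ρ)) {x : L} (hx : x ∈ part L 0) (h0 : f x = 0) (y : L) :
    f (φ x y) = ρ x (f y) := by
  suffices h : f ∘ₗ φ x = ρ x ∘ₗ f from LinearMap.congr_fun h y
  refine linearMap_ext_part fun j y hy => ?_
  have h := cobdry_apply_of_mem φ ρ f hx hy
  rw [LinearMap.mem_ker.1 hf, LinearMap.zero_apply, LinearMap.zero_apply, eq_comm,
    sub_eq_zero] at h
  rw [LinearMap.comp_apply, ← h, LinearMap.comp_apply, sum_zmod_two, h0]
  conv_rhs => rw [← proj_sum_shift j (f y)]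
  simp only [sgn_zero_right, one_smul, map_add, map_zero, smul_zero, sub_zero]

theorem derPart_le_ker_cobdry (φ : L →ₗ[ℂ] L →ₗ[ℂ] L) (ρ : L →ₗ[ℂ] V →ₗ[ℂ] V) (p : ZMod 2) :
    derPart φ ρ p ≤ LinearMap.ker (cobdry φ ρ) := by
  rintro f ⟨hg, hd⟩
  refine LinearMap.mem_ker.2 (linearMap_ext_part fun i x hx => linearMap_ext_part fun j y hy => ?_)
  rw [cobdry_apply_of_mem φ ρ f hx hy, sum_zmod_two, hd i j x hx y hy,
    proj_of_mem (hg i x hx), proj_of_mem (hg i x hx), proj_of_mem (hg j y hy),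
    proj_of_mem (hg j y hy)]
  rcases zmod_two_cases p with rfl | rfl <;> simp

theorem innMap_apply_of_mem (ρ : L →ₗ[ℂ] V →ₗ[ℂ] V) {p i : ZMod 2} {a : V} {x : L}
    (ha : a ∈ part V p) (hx : x ∈ part L i) : innMap ρ a x = sgn p i • ρ x a := by
  simp only [innMap, sum_zmod_two, LinearMap.add_apply, LinearMap.smul_apply,
    LinearMap.compl₁₂_apply, proj_of_mem ha, proj_of_mem hx, LinearMap.flip_apply]
  rcases zmod_two_cases i with rfl | rfl <;> rcases zmod_two_cases p with rfl | rfl <;> simp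

theorem innMap_apply_even (ρ : L →ₗ[ℂ] V →ₗ[ℂ] V) {x : L} (hx : x ∈ part L 0) (a : V) :
    innMap ρ a x = ρ x a := by
  conv_lhs => rw [← SuperSpace.proj_add a]
  conv_rhs => rw [← SuperSpace.proj_add a]
  simp only [map_add, LinearMap.add_apply, innMap_apply_of_mem ρ (proj_mem _ a) hx,
    sgn_zero_right, one_smul]

/-- Over a graded module, the map `a_Inn` is a derivation of the parity of `a`. -/
theorem innPart_le_derPart {φ : L →ₗ[ℂ] L →ₗ[ℂ] L} {ρ : L →ₗ[ℂ] V →ₗ[ℂ] V}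
    (hφ : ∀ i j : ZMod 2, ∀ x ∈ part L i, ∀ y ∈ part L j, φ x y ∈ part L (i + j))
    (hρ : ∀ i j : ZMod 2, ∀ x ∈ part L i, ∀ v ∈ part V j, ρ x v ∈ part V (i + j))
    (hm : ∀ i j : ZMod 2, ∀ x ∈ part L i, ∀ y ∈ part L j, ∀ v,
      ρ (φ x y) v = ρ x (ρ y v) - sgn i j • ρ y (ρ x v)) (p : ZMod 2) :
    innPart ρ p ≤ derPart φ ρ p := by
  rintro _ ⟨a, ha, rfl⟩
  refine ⟨fun i x hx => ?_, fun i j x hx y hy => ?_⟩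
  · rw [innMap_apply_of_mem ρ ha hx]
    exact Submodule.smul_mem _ _ (hρ i p x hx a ha)
  · rw [innMap_apply_of_mem ρ ha hx, innMap_apply_of_mem ρ ha hy,
      innMap_apply_of_mem ρ ha (hφ i j x hx y hy), hm i j x hx y hy]
    have e : sgn j (p + i) * sgn p i = sgn p (i + j) * sgn i j := by
      rw [sgn_add_right, sgn_add_right, sgn_comm j p, sgn_comm j i]; ring
    simp only [map_smul, smul_sub, smul_smul, e]
    rw [sgn_add_right]

theorem parityComponent_of_mem_derPart {φ : L →ₗ[ℂ] L →ₗ[ℂ] L} {ρ : L →ₗ[ℂ] V →ₗ[ℂ] V}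
    {p : ZMod 2} {f : L →ₗ[ℂ] V} (hf : f ∈ derPart φ ρ p) : parityComponent p f = f :=
  linearMap_ext_part fun i x hx => by
    rw [parityComponent_apply_of_mem f p hx, proj_of_mem (hf.1 i x hx), if_pos rfl]

theorem parityComponent_innMap {ρ : L →ₗ[ℂ] V →ₗ[ℂ] V}
    (hρ : ∀ i j : ZMod 2, ∀ x ∈ part L i, ∀ v ∈ part V j, ρ x v ∈ part V (i + j))
    (p : ZMod 2) (a : V) : parityComponent p (innMap ρ a) = innMap ρ (proj p a) := by
  refine linearMap_ext_part fun i x hx => ?_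
  rw [parityComponent_apply_of_mem _ p hx]
  conv_lhs => rw [← SuperSpace.proj_add a]
  simp only [map_add, LinearMap.add_apply, innMap_apply_of_mem ρ (proj_mem _ a) hx, map_smul,
    proj_of_mem (hρ i _ x hx _ (proj_mem _ a)), add_right_inj]
  rcases zmod_two_cases p with rfl | rfl <;> simp

/-- If every cocycle is a coboundary, then `H¹` vanishes and all derivations are inner. -/
theorem subsingleton_H1_and_der_eq_inn {φ : L →ₗ[ℂ] L →ₗ[ℂ] L} {ρ : L →ₗ[ℂ] V →ₗ[ℂ] V}
    (hφ : ∀ i j : ZMod 2, ∀ x ∈ part L i, ∀ y ∈ part L j, φ x y ∈ part L (i + j))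
    (hρ : ∀ i j : ZMod 2, ∀ x ∈ part L i, ∀ v ∈ part V j, ρ x v ∈ part V (i + j))
    (hm : ∀ i j : ZMod 2, ∀ x ∈ part L i, ∀ y ∈ part L j, ∀ v,
      ρ (φ x y) v = ρ x (ρ y v) - sgn i j • ρ y (ρ x v))
    (h : LinearMap.ker (cobdry φ ρ) ≤ LinearMap.range (innMap ρ)) :
    Subsingleton (H1 φ ρ) ∧ der φ ρ = inn ρ := by
  refine ⟨Submodule.Quotient.subsingleton_iff.2 ?_, le_antisymm ?_ ?_⟩
  · exact Submodule.submoduleOf_eq_top.2 h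
  · have key : ∀ p, derPart φ ρ p ≤ innPart ρ p := by
      intro p f hf
      obtain ⟨a, ha⟩ := h (derPart_le_ker_cobdry φ ρ p hf)
      exact ⟨proj p a, proj_mem p a,
        by rw [← parityComponent_innMap hρ, ha, parityComponent_of_mem_derPart hf]⟩
    exact sup_le_sup (key 0) (key 1)
  · exact sup_le_sup (innPart_le_derPart hφ hρ hm 0) (innPart_le_derPart hφ hρ hm 1)

theorem innMap_mem_ker_cobdry {φ : L →ₗ[ℂ] L →ₗ[ℂ] L} {ρ : L →ₗ[ℂ] V →ₗ[ℂ] V}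
    (hφ : ∀ i j : ZMod 2, ∀ x ∈ part L i, ∀ y ∈ part L j, φ x y ∈ part L (i + j))
    (hρ : ∀ i j : ZMod 2, ∀ x ∈ part L i, ∀ v ∈ part V j, ρ x v ∈ part V (i + j))
    (hm : ∀ i j : ZMod 2, ∀ x ∈ part L i, ∀ y ∈ part L j, ∀ v,
      ρ (φ x y) v = ρ x (ρ y v) - sgn i j • ρ y (ρ x v)) (a : V) :
    innMap ρ a ∈ LinearMap.ker (cobdry φ ρ) := by
  rw [← SuperSpace.proj_add a, map_add]
  exact add_mem (derPart_le_ker_cobdry φ ρ 0 (innPart_le_derPart hφ hρ hm 0 ⟨_, proj_mem _ a, rfl⟩))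
    (derPart_le_ker_cobdry φ ρ 1 (innPart_le_derPart hφ hρ hm 1 ⟨_, proj_mem _ a, rfl⟩))

/-! ### The adjoint diagonal action is a graded module -/

theorem tmul_mem_part {i j : ZMod 2} {a : L} {b : V} (ha : a ∈ part L i) (hb : b ∈ part V j) :
    a ⊗ₜ[ℂ] b ∈ part (L ⊗[ℂ] V) (i + j) := by
  refine mem_part_iff.2 ?_
  change (∑ l : ZMod 2, TensorProduct.map (proj l) (proj (i + j - l))) (a ⊗ₜ[ℂ] b) = _
  simp only [sum_zmod_two, LinearMap.add_apply, TensorProduct.map_tmul, proj_of_mem ha,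
    proj_of_mem hb]
  rcases zmod_two_cases i with rfl | rfl <;> simp

theorem exists_homogeneous_of_mem_part {k : ZMod 2} {v : L ⊗[ℂ] V}
    (hv : v ∈ part (L ⊗[ℂ] V) k) :
    v ∈ Submodule.span ℂ {w | ∃ i j : ZMod 2, i + j = k ∧
      ∃ a ∈ part L i, ∃ b ∈ part V j, w = a ⊗ₜ[ℂ] b} := by
  obtain ⟨u, rfl⟩ := hv
  induction u with
  | zero => simp
  | add x y hx hy => rw [map_add]; exact add_mem hx hy
  | tmul x y =>
    change (∑ l : ZMod 2, TensorProduct.map (proj l) (proj (k - l))) (x ⊗ₜ[ℂ] y) ∈ _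
    rw [LinearMap.sum_apply]
    exact Submodule.sum_mem _ fun l _ => Submodule.subset_span
      ⟨l, k - l, by abel, _, proj_mem _ _, _, proj_mem _ _, rfl⟩

theorem adjTensor_mem_part {φ : L →ₗ[ℂ] L →ₗ[ℂ] L}
    (hφ : ∀ i j : ZMod 2, ∀ x ∈ part L i, ∀ y ∈ part L j, φ x y ∈ part L (i + j))
    (i k : ZMod 2) (x : L) (hx : x ∈ part L i) (v : L ⊗[ℂ] L) (hv : v ∈ part (L ⊗[ℂ] L) k) :
    adjTensor φ x v ∈ part (L ⊗[ℂ] L) (i + k) := by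
  have h : part (L ⊗[ℂ] L) k ≤ (part (L ⊗[ℂ] L) (i + k)).comap (adjTensor φ x) := by
    refine le_trans (fun v hv => exists_homogeneous_of_mem_part hv) (Submodule.span_le.2 ?_)
    rintro _ ⟨j, l, rfl, a, ha, b, hb, rfl⟩
    rw [SetLike.mem_coe, Submodule.mem_comap, adjTensor_tmul φ hx ha]
    refine add_mem ?_ (Submodule.smul_mem _ _ ?_)
    · rw [← add_assoc]; exact tmul_mem_part (hφ i j x hx a ha) hb
    · rw [add_left_comm]; exact tmul_mem_part ha (hφ i l x hx b hb)
  exact h hv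

/-- The super-Jacobi identity makes `L ⊗ L` a module over `L`. -/
theorem adjTensor_bracket {φ : L →ₗ[ℂ] L →ₗ[ℂ] L}
    (hφ : ∀ i j : ZMod 2, ∀ x ∈ part L i, ∀ y ∈ part L j, φ x y ∈ part L (i + j))
    (hJ : ∀ i j : ZMod 2, ∀ x ∈ part L i, ∀ y ∈ part L j, ∀ z,
      φ (φ x y) z = φ x (φ y z) - sgn i j • φ y (φ x z))
    (i j : ZMod 2) (x : L) (hx : x ∈ part L i) (y : L) (hy : y ∈ part L j) (v : L ⊗[ℂ] L) :
    adjTensor φ (φ x y) v =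
      adjTensor φ x (adjTensor φ y v) - sgn i j • adjTensor φ y (adjTensor φ x v) := by
  have key : ∀ k, ∀ a ∈ part L k, ∀ b, adjTensor φ (φ x y) (a ⊗ₜ b) =
      adjTensor φ x (adjTensor φ y (a ⊗ₜ b)) -
        sgn i j • adjTensor φ y (adjTensor φ x (a ⊗ₜ b)) := by
    intro k a ha b
    rw [adjTensor_tmul φ (hφ i j x hx y hy) ha, adjTensor_tmul φ hx ha, adjTensor_tmul φ hy ha,
      map_add, map_add, map_smul, map_smul, adjTensor_tmul φ hx ha,
      adjTensor_tmul φ hx (hφ j k y hy a ha), adjTensor_tmul φ hy ha,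
      adjTensor_tmul φ hy (hφ i k x hx a ha), hJ i j x hx y hy, hJ i j x hx y hy]
    simp only [TensorProduct.sub_tmul, TensorProduct.tmul_sub, ← TensorProduct.smul_tmul',
      TensorProduct.tmul_smul, sgn_add_left, sgn_add_right]
    have h2 := sgn_mul_self i j
    rw [sgn_comm j i]
    match_scalars <;> first | ring1 | linear_combination sgn j k * h2
  induction v with
  | zero => simp
  | add v w hv hw => rw [map_add, hv, hw]; simp only [map_add, smul_add]; abel
  | tmul a b =>
    rw [← SuperSpace.proj_add a, TensorProduct.add_tmul]
    simp only [map_add, key _ _ (proj_mem _ a) b, smul_add]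
    abel

end Homogeneous

/-! ### The superalgebra axioms of `WAlg` -/

/-- A property of the vectors of parity `i` that is closed under addition holds if it holds for the
multiples of the basis vectors of parity `i`. -/
theorem part_induction {i : ZMod 2} {P : WAlg Γ s → Prop} (h0 : P 0)
    (hadd : ∀ x y, P x → P y → P (x + y))
    (hs : ∀ a c, Idx.parity a = i → P (Finsupp.single a c)) {x : WAlg Γ s}
    (hx : x ∈ part (WAlg Γ s) i) : P x := by
  rw [← mem_part_iff.1 hx]
  clear hx
  induction x using Finsupp.induction_linear with
  | zero => rwa [map_zero]
  | add x y hx hy => rw [map_add]; exact hadd _ _ hx hy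
  | single a c =>
    rw [proj_single]
    split_ifs with h
    exacts [hs a c h, h0]

theorem basisBracket_mem (hs : 2 * s ∈ Γ) (a b : Idx Γ s) :
    basisBracket hs a b ∈ part (WAlg Γ s) (a.parity + b.parity) := by
  rw [mem_part_iff]
  cases a <;> cases b <;> simp [basisBracket, Idx.parity, proj_single, -Finsupp.single_sub,
    show (1 + 1 : ZMod 2) = 0 from rfl]

theorem bracket_graded (hs : 2 * s ∈ Γ) (i j : ZMod 2) (x : WAlg Γ s)
    (hx : x ∈ part (WAlg Γ s) i) (y : WAlg Γ s) (hy : y ∈ part (WAlg Γ s) j) :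
    bracket hs x y ∈ part (WAlg Γ s) (i + j) := by
  refine part_induction (P := fun x => bracket hs x y ∈ _) ?_ ?_ ?_ hx
  · simp
  · intro x x' h h'; rw [map_add, LinearMap.add_apply]; exact add_mem h h'
  · rintro a c rfl
    refine part_induction (P := fun y => bracket hs _ y ∈ _) ?_ ?_ ?_ hy
    · simp
    · intro x x' h h'; rw [map_add]; exact add_mem h h'
    · rintro b d rfl
      rw [bracket_single]
      exact Submodule.smul_mem _ _ (basisBracket_mem hs a b)

theorem basisBracket_jacobi (hs : 2 * s ∈ Γ) (a b c : Idx Γ s) :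
    bracket hs (basisBracket hs a b) (Finsupp.single c 1) =
      bracket hs (Finsupp.single a 1) (basisBracket hs b c) -
        sgn a.parity b.parity • bracket hs (Finsupp.single b 1) (basisBracket hs a c) := by
  cases a <;> cases b <;> cases c <;>
    simp only [basisBracket, map_neg, map_zero, bracket_single, LinearMap.neg_apply,
      LinearMap.zero_apply, Idx.parity, sgn_zero_left, sgn_zero_right, sgn_one_one, one_smul,
      neg_smul, smul_zero, smul_neg, Finsupp.smul_single, smul_eq_mul, add_left_comm, add_comm,
      neg_neg, neg_zero, sub_zero, sub_neg_eq_add] <;>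
    simp only [← Finsupp.single_add, ← Finsupp.single_sub, ← Finsupp.single_neg] <;>
    congr 1 <;> push_cast <;> ring

theorem bracket_jacobi (hs : 2 * s ∈ Γ) (i j : ZMod 2) (x : WAlg Γ s)
    (hx : x ∈ part (WAlg Γ s) i) (y : WAlg Γ s) (hy : y ∈ part (WAlg Γ s) j) (z : WAlg Γ s) :
    bracket hs (bracket hs x y) z =
      bracket hs x (bracket hs y z) - sgn i j • bracket hs y (bracket hs x z) := by
  refine part_induction (P := fun x => bracket hs (bracket hs x y) z =
    bracket hs x (bracket hs y z) - sgn i j • bracket hs y (bracket hs x z)) ?_ ?_ ?_ hx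
  · simp
  · intro x x' h h'; simp only [map_add, LinearMap.add_apply, h, h', smul_add]; abel
  · rintro a c rfl
    refine part_induction (P := fun y => bracket hs (bracket hs _ y) z =
      bracket hs _ (bracket hs y z) - sgn a.parity j • bracket hs y (bracket hs _ z)) ?_ ?_ ?_ hy
    · simp
    · intro x x' h h'; simp only [map_add, LinearMap.add_apply, h, h', smul_add]; abel
    · rintro b d rfl
      induction z using Finsupp.induction_linear with
      | zero => simp
      | add z z' h h' => simp only [map_add, h, h', smul_add]; abel
      | single l e =>
        have h := basisBracket_jacobi hs a b l
        rw [← mul_one c, ← mul_one d, ← mul_one e, ← smul_eq_mul c, ← smul_eq_mul d,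
          ← smul_eq_mul e, ← Finsupp.smul_single, ← Finsupp.smul_single, ← Finsupp.smul_single]
        simp only [map_smul, LinearMap.smul_apply]
        rw [bracket_single, bracket_single _ b, bracket_single _ a l]
        simp only [mul_one, one_smul, h]
        module

/-! ### Cocycles of `WAlg` with values in `WAlg ⊗ WAlg` -/

theorem innMap_basisL (hs : 2 * s ∈ Γ) (k : Γ) (u : WAlg Γ s ⊗[ℂ] WAlg Γ s) :
    innMap (adjTensor (bracket hs)) u (basisL s k) = act hs k u :=
  innMap_apply_even _ (basisL_mem k) u

/-- The `1`-cocycles of `WAlg` with values in `WAlg ⊗ WAlg`. -/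
abbrev cocycles (hs : 2 * s ∈ Γ) : Submodule ℂ (WAlg Γ s →ₗ[ℂ] WAlg Γ s ⊗[ℂ] WAlg Γ s) :=
  LinearMap.ker (cobdry (bracket hs) (adjTensor (bracket hs)))

theorem innMap_mem_cocycles (hs : 2 * s ∈ Γ) (u : WAlg Γ s ⊗[ℂ] WAlg Γ s) :
    innMap (adjTensor (bracket hs)) u ∈ cocycles hs :=
  innMap_mem_ker_cobdry (bracket_graded hs) (adjTensor_mem_part (bracket_graded hs))
    (adjTensor_bracket (bracket_graded hs) (bracket_jacobi hs)) u

section Cocycle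

variable {hs : 2 * s ∈ Γ} {f : WAlg Γ s →ₗ[ℂ] WAlg Γ s ⊗[ℂ] WAlg Γ s}

theorem cocycle_basisL (hf : f ∈ cocycles hs) (k l : Γ) :
    ((k : ℂ) - l) • f (basisL s (k + l)) =
      act hs k (f (basisL s l)) - act hs l (f (basisL s k)) := by
  have h := cocycle_even_even hf (basisL_mem k) (basisL_mem l)
  rwa [bracket_basisL_basisL, map_smul] at h

theorem cocycle_basisL_of_eq_zero (hf : f ∈ cocycles hs) {k : Γ} (hk : f (basisL s k) = 0)
    (l : Γ) : ((k : ℂ) - l) • f (basisL s (k + l)) = act hs k (f (basisL s l)) := by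
  have h := cocycle_of_eq_zero hf (basisL_mem k) hk (basisL s l)
  rwa [bracket_basisL_basisL, map_smul] at h

/-- A cocycle vanishing on `L_k` and `L_{-k}` for arbitrarily large `k` vanishes. -/
theorem cocycle_eq_zero (hf : f ∈ cocycles hs)
    (h : ∀ K : ℝ, ∃ k : Γ, K < k ∧ f (basisL s k) = 0 ∧ f (basisL s (-k)) = 0) : f = 0 := by
  refine Finsupp.lhom_ext' fun i => LinearMap.ext_ring ?_
  obtain ⟨K, hK⟩ := eq_zero_of_act_act hs (f (Finsupp.single i 1))
  obtain ⟨k, hk, h1, h2⟩ := h K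
  refine hK k hk ((i.coeff k) * (i.shift k).coeff (-k)) ?_
  rw [act, act, ← cocycle_of_eq_zero hf (basisL_mem k) h1,
    ← cocycle_of_eq_zero hf (basisL_mem (-k)) h2, bracket_basisL, bracket_basisL, ← map_smul]
  simp

/-- A cocycle vanishing on `L_n` and `L_{2n}` with `n > 0` vanishes: it vanishes on the `L_{jn}` with
`j > 0`, which these two generate, and its values on those with `j < 0` are killed by `L_k` for
all large multiples `k` of `n`. -/
theorem cocycle_eq_zero_of_generators (hf : f ∈ cocycles hs) {n : Γ} (hn : 0 < (n : ℝ))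
    (h1 : f (basisL s n) = 0) (h2 : f (basisL s (n + n)) = 0) : f = 0 := by
  have hpos : ∀ m : ℕ, f (basisL s ((m + 1) • n)) = 0 := by
    intro m
    induction m with
    | zero => simpa using h1
    | succ m ih =>
      rcases Nat.eq_zero_or_pos m with rfl | hm
      · simpa [two_nsmul] using h2
      · have h := cocycle_basisL_of_eq_zero hf ih n
        rw [h1, map_zero] at h
        rw [succ_nsmul]
        refine (smul_eq_zero.1 h).resolve_left ?_
        have : ((((m + 1) • n : Γ) : ℝ) - (n : ℝ)) ≠ 0 := by
          have : (0 : ℝ) < m := by exact_mod_cast hm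
          push_cast
          rw [nsmul_eq_mul]; push_cast
          nlinarith [mul_pos this hn]
        exact_mod_cast this
  have large : ∀ K : ℝ, ∃ m : ℕ, ∀ l ≥ m, K < (((l + 1) • n : Γ) : ℝ) := by
    intro K
    obtain ⟨m, hm⟩ := exists_nat_gt (K / n)
    refine ⟨m, fun l hl => ?_⟩
    push_cast
    rw [nsmul_eq_mul]; push_cast
    rw [div_lt_iff₀ hn] at hm
    have : (m : ℝ) ≤ l := by exact_mod_cast hl
    nlinarith
  have hneg : ∀ m : ℕ, f (basisL s (-((m + 1) • n))) = 0 := by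
    intro m
    obtain ⟨K, hK⟩ := eq_zero_of_act_eq_zero hs (f (basisL s (-((m + 1) • n))))
    obtain ⟨l, hl⟩ := large K
    refine hK ((l + m + 1 + 1) • n) (hl _ (by omega)) ?_
    have h := cocycle_basisL_of_eq_zero hf (hpos (l + m + 1)) (-((m + 1) • n))
    refine h.symm.trans ?_
    rw [show (l + m + 1 + 1) • n + -((m + 1) • n) = (l + 1) • n by
      rw [show l + m + 1 + 1 = (l + 1) + (m + 1) by ring, add_nsmul]; abel, hpos, smul_zero]
  refine cocycle_eq_zero hf fun K => ?_
  obtain ⟨l, hl⟩ := large K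
  exact ⟨_, hl l le_rfl, hpos l, hneg l⟩

end Cocycle

/-! ### The linear system of a cocycle on `L_n`, `L_{-n}`, `L_{2n}` -/

/-- The homogeneous system left after subtracting an inner derivation. For `a ≠ b` the determinant
of the first two equations in `β`, `δ` is a nonzero constant. For `a = b` they only say `δ = -β`,
and then eliminating `y`, `z` from the other three leaves a nonzero constant times `β`. -/
theorem reduced_system {a b Q : ℝ} (ha : a = 1 ∨ a = 1 / 2) (hb : b = 1 ∨ b = 1 / 2)
    (hQ : -(1 / 2) < Q) {β δ y z : ℂ}
    (h1 : (b + Q + 1) * δ = -(a + Q + 1) * β) (h2 : (a - Q) * δ = (Q - b) * β)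
    (h3 : (a + Q + 1) * y + (2 * b + Q + 1) * δ = 0)
    (h4 : 3 * β = (a + Q + 2) * z + (b - Q + 1) * y) (h5 : (Q - b) * z = (2 * a - Q) * δ) :
    β = 0 ∧ δ = 0 ∧ y = 0 ∧ z = 0 := by
  have ha0 : 0 < a := by rcases ha with rfl | rfl <;> norm_num
  have hb0 : 0 < b := by rcases hb with rfl | rfl <;> norm_num
  have n1 : (b + Q + 1 : ℂ) ≠ 0 := by
    exact_mod_cast (by linarith : (0 : ℝ) < b + Q + 1).ne'
  have n2 : (a + Q + 1 : ℂ) ≠ 0 := by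
    exact_mod_cast (by linarith : (0 : ℝ) < a + Q + 1).ne'
  have n3 : (a + Q + 2 : ℂ) ≠ 0 := by
    exact_mod_cast (by linarith : (0 : ℝ) < a + Q + 2).ne'
  have hβ : β = 0 := by
    rcases ha with rfl | rfl <;> rcases hb with rfl | rfl <;> push_cast at *
    · have hd : δ = -β := mul_left_cancel₀ n1 (by linear_combination h1)
      subst hd
      have : (12 : ℂ) * β = 0 := by
        linear_combination ((1 + Q + 2) * (1 + Q + 1) : ℂ) * h5 +
          ((Q - 1) * (1 + Q + 1) : ℂ) * h4 + ((Q - 1) * (1 - Q + 1) : ℂ) * h3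
      simpa using this
    · have : (5 / 4 : ℂ) * β = 0 := by
        linear_combination (1 - Q : ℂ) * h1 - (1 / 2 + Q + 1 : ℂ) * h2
      simpa using this
    · have : (-(5 / 4) : ℂ) * β = 0 := by
        linear_combination (1 / 2 - Q : ℂ) * h1 - (1 + Q + 1 : ℂ) * h2
      simpa using this
    · have hd : δ = -β := mul_left_cancel₀ n1 (by linear_combination h1)
      subst hd
      have : (3 : ℂ) * β = 0 := by
        linear_combination ((1 / 2 + Q + 2) * (1 / 2 + Q + 1) : ℂ) * h5 +
          ((Q - 1 / 2) * (1 / 2 + Q + 1) : ℂ) * h4 + ((Q - 1 / 2) * (1 / 2 - Q + 1) : ℂ) * h3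
      simpa using this
  subst hβ
  have hδ : δ = 0 := (mul_eq_zero.1 (by linear_combination h1)).resolve_left n1
  subst hδ
  have hy : y = 0 := (mul_eq_zero.1 (by linear_combination h3)).resolve_left n2
  subst hy
  exact ⟨rfl, rfl, rfl, (mul_eq_zero.1 (by linear_combination -h4)).resolve_left n3⟩

/-- The coordinates of a cocycle along one family of pairs of basis vectors: `α`, `β` are those
of the value at `L_n`, then `γ`, `δ` at `L_{-n}` and `x`, `y`, `z` at `L_{2n}`. All are determined
by `α` as for an inner derivation. The numbers `a`, `b` are the weights of the two basis
vectors, and degrees are measured in units of `n`. -/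
theorem generator_system {a b Q : ℝ} (ha : a = 1 ∨ a = 1 / 2) (hb : b = 1 ∨ b = 1 / 2)
    (hQ : -(1 / 2) < Q) {α β γ δ x y z : ℂ}
    (e1 : (b + Q) * γ = (-a - Q) * α)
    (e2 : (a - Q + 1) * γ + (b + Q + 1) * δ = (-a - Q - 1) * β + (-b + Q - 1) * α)
    (e3 : (a - Q) * δ = (-b + Q) * β)
    (e4 : (-a - Q) * x = (2 * b + Q) * γ)
    (e5 : -3 * α = (-a - Q - 1) * y + (-b + Q - 2) * x - (2 * b + Q + 1) * δ)
    (e6 : -3 * β = (-a - Q - 2) * z + (-b + Q - 1) * y - (2 * a - Q + 1) * γ)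
    (e7 : (-b + Q) * z = (2 * a - Q) * δ) :
    β = (a - Q) * (α / (b + Q)) ∧ x = (2 * b + Q) * (α / (b + Q)) ∧ y = 0 ∧
      z = (2 * a - Q) * (α / (b + Q)) := by
  have ha0 : 1 / 2 ≤ a := by rcases ha with rfl | rfl <;> norm_num
  have hb0 : 1 / 2 ≤ b := by rcases hb with rfl | rfl <;> norm_num
  have n1 : (b + Q : ℂ) ≠ 0 := by
    exact_mod_cast (by linarith : (0 : ℝ) < b + Q).ne'
  have n2 : (a + Q : ℂ) ≠ 0 := by
    exact_mod_cast (by linarith : (0 : ℝ) < a + Q).ne'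
  obtain ⟨u, hu⟩ : ∃ u, u = α / (b + Q : ℂ) := ⟨_, rfl⟩
  rw [← hu]
  have hα : α = (b + Q) * u := by rw [hu]; field_simp
  clear hu
  subst hα
  have hγ : γ = (-a - Q) * u := mul_left_cancel₀ n1 (by linear_combination e1)
  subst hγ
  have hx : x = (2 * b + Q) * u := mul_left_cancel₀ n2 (by linear_combination -e4)
  subst hx
  obtain ⟨h1, -, h3, h4⟩ := reduced_system ha hb hQ (β := β - (a - Q) * u)
    (δ := δ + (b - Q) * u) (y := y) (z := z - (2 * a - Q) * u)
    (by linear_combination e2) (by linear_combination e3) (by linear_combination e5)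
    (by linear_combination -e6) (by linear_combination e7)
  exact ⟨sub_eq_zero.1 h1, rfl, h3, sub_eq_zero.1 h4⟩

/-! ### Normalising a cocycle -/

theorem coord_act_zero (hs : 2 * s ∈ Γ) (v : WAlg Γ s ⊗[ℂ] WAlg Γ s) (i j : Idx Γ s) :
    coord i j (act hs 0 v) = -((i.deg + j.deg : ℝ) : ℂ) * coord i j v := by
  rw [coord_act, neg_zero, Idx.shift_zero, Idx.shift_zero, Idx.coeff, Idx.coeff]
  push_cast
  simp
  ring

theorem exists_large (hΓ : Γ ≠ ⊥) (K : ℝ) : ∃ k : Γ, K < k := by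
  obtain ⟨⟨p, hp⟩, hne⟩ := AddSubgroup.ne_bot_iff_exists_ne_zero.1 hΓ
  have hp0 : p ≠ 0 := fun h => hne (Subtype.ext h)
  obtain ⟨m, hm⟩ := exists_nat_gt (K / |p|)
  have : |p| ∈ Γ := by rcases abs_choice p with h | h <;> rw [h]; exacts [hp, Γ.neg_mem hp]
  refine ⟨m • ⟨|p|, this⟩, ?_⟩
  rw [div_lt_iff₀ (abs_pos.2 hp0)] at hm
  simpa using hm

section Cocycle

variable {hs : 2 * s ∈ Γ} {f : WAlg Γ s →ₗ[ℂ] WAlg Γ s ⊗[ℂ] WAlg Γ s}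

theorem coord_cocycle (hf : f ∈ cocycles hs) (k l : Γ) (i j : Idx Γ s) :
    ((k : ℂ) - l) * coord i j (f (basisL s (k + l))) =
      coord i j (act hs k (f (basisL s l))) - coord i j (act hs l (f (basisL s k))) := by
  rw [← map_sub, ← cocycle_basisL hf, map_smul, smul_eq_mul]

/-- Subtracting an inner derivation from a cocycle, in additive form. -/
theorem exists_sub_innMap (hf : f ∈ cocycles hs) (u : WAlg Γ s ⊗[ℂ] WAlg Γ s) :
    ∃ g ∈ cocycles hs, f = g + innMap (adjTensor (bracket hs)) u := by
  have h := innMap_mem_cocycles hs u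
  generalize innMap (adjTensor (bracket hs)) u = e at h ⊢
  refine ⟨f + (-1 : ℂ) • e, add_mem hf (Submodule.smul_mem _ _ h), ?_⟩
  have h1 : (-1 : ℂ) • e + (1 : ℂ) • e = 0 := by rw [← add_smul, neg_add_cancel, zero_smul]
  rw [one_smul] at h1
  rw [add_assoc, h1, add_zero]

/-- If the value of a cocycle at `L_0` is homogeneous of degree `0`, it is invariant under all
`L_k`, hence zero. -/
theorem cocycle_zero_eq_zero (hΓ : Γ ≠ ⊥) (hf : f ∈ cocycles hs)
    (h : ∀ i j, i.deg + j.deg ≠ 0 → coord i j (f (basisL s 0)) = 0) : f (basisL s 0) = 0 := by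
  obtain ⟨K, hK⟩ := eq_zero_of_act_eq_zero hs (f (basisL s 0))
  obtain ⟨k, hk⟩ := exists_large hΓ K
  refine hK k hk (coord_ext fun i j => ?_)
  rw [map_zero]
  by_cases hd : i.deg + j.deg = k
  · have h1 := coord_cocycle hf k 0 i j
    rw [coord_act_zero, hd, add_zero] at h1
    push_cast at h1
    linear_combination -h1
  · rw [coord_act, h _ _ (by rw [Idx.deg_shift]; push_cast; intro h'; apply hd; linarith),
      h _ _ (by rw [Idx.deg_shift]; push_cast; intro h'; apply hd; linarith)]
    simp

theorem exists_inner_at_zero (hΓ : Γ ≠ ⊥) (hf : f ∈ cocycles hs) :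
    ∃ g ∈ cocycles hs, ∃ u, f = g + innMap (adjTensor (bracket hs)) u ∧
      g (basisL s 0) = 0 := by
  obtain ⟨u, hu⟩ := exists_coord_eq
    (fun i j => -coord i j (f (basisL s 0)) / ((i.deg + j.deg : ℝ) : ℂ))
    ((finite_coord_ne_zero (f (basisL s 0))).subset fun p hp h => hp (by simp [h]))
  obtain ⟨g, hg, hfg⟩ := exists_sub_innMap hf u
  refine ⟨g, hg, u, hfg, cocycle_zero_eq_zero hΓ hg fun i j hij => ?_⟩
  have h := congrArg (fun f => coord i j (f (basisL s 0))) hfg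
  simp only [LinearMap.add_apply, innMap_basisL, map_add, coord_act_zero, hu] at h
  have : ((i.deg + j.deg : ℝ) : ℂ) ≠ 0 := Complex.ofReal_ne_zero.2 hij
  field_simp at h
  linear_combination -h

/-- A cocycle vanishing at `L_0` preserves degrees. -/
theorem deg_of_coord_ne_zero (hf : f ∈ cocycles hs) (h0 : f (basisL s 0) = 0) {k : Γ}
    {i j : Idx Γ s} (h : coord i j (f (basisL s k)) ≠ 0) : i.deg + j.deg = k := by
  have h1 := coord_cocycle hf 0 k i j
  rw [h0, map_zero, map_zero, coord_act_zero, zero_add] at h1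
  have h2 : (((i.deg + j.deg : ℝ) : ℂ) - ((k : ℝ) : ℂ)) * coord i j (f (basisL s k)) = 0 := by
    push_cast at h1 ⊢
    linear_combination h1
  have h3 := (mul_eq_zero.1 h2).resolve_right h
  rw [sub_eq_zero] at h3
  exact_mod_cast h3

/-- The degrees occurring in the values of a cocycle at `L_p`, `L_{2p}`, `L_{3p}`, … are bounded on
the side opposite to `p`, uniformly: all these values are generated by the first two, and the
action of `L_{mp}` with `m > 0` only moves degrees in the direction of `p`. The number `σ`, of
the same sign as `p`, treats both directions at once. -/
theorem exists_uniform_bound (hf : f ∈ cocycles hs) {p : Γ} {σ : ℝ} (hσ : 0 < σ * p) :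
    ∃ A : ℝ, ∀ m : ℕ, ∀ i j, coord i j (f (basisL s ((m + 1) • p))) ≠ 0 →
      -A ≤ σ * i.deg ∧ -A ≤ σ * j.deg := by
  obtain ⟨B, hB⟩ := exists_coord_bound (f (basisL s p))
  obtain ⟨C, hC⟩ := exists_coord_bound (f (basisL s (p + p)))
  have bd : ∀ {D x : ℝ}, D ≤ max B C → |x| ≤ D → -(|σ| * max B C) ≤ σ * x := by
    intro D x hD hx
    have : |σ * x| ≤ |σ| * max B C := by
      rw [abs_mul]; exact mul_le_mul_of_nonneg_left (hx.trans hD) (abs_nonneg _)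
    exact (abs_le.1 this).1
  refine ⟨|σ| * max B C, fun m => ?_⟩
  have base : ∀ i j, coord i j (f (basisL s p)) ≠ 0 →
      -(|σ| * max B C) ≤ σ * i.deg ∧ -(|σ| * max B C) ≤ σ * j.deg := fun i j h =>
    ⟨bd (le_max_left _ _) (hB i j h).1, bd (le_max_left _ _) (hB i j h).2⟩
  have step : ∀ (k : Γ) (v : WAlg Γ s ⊗[ℂ] WAlg Γ s), 0 ≤ σ * k →
      (∀ i j, coord i j v ≠ 0 → -(|σ| * max B C) ≤ σ * i.deg ∧ -(|σ| * max B C) ≤ σ * j.deg) →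
      ∀ i j, coord i j (act hs k v) ≠ 0 →
        -(|σ| * max B C) ≤ σ * i.deg ∧ -(|σ| * max B C) ≤ σ * j.deg := by
    intro k v hk hv i j hij
    rw [coord_act] at hij
    by_cases h1 : coord (i.shift (-k)) j v = 0
    · have h2 : coord i (j.shift (-k)) v ≠ 0 := fun h => hij (by rw [h1, h]; simp)
      have := hv _ _ h2
      rw [Idx.deg_shift] at this
      push_cast at this
      exact ⟨this.1, by linarith [this.2]⟩
    · have := hv _ _ h1
      rw [Idx.deg_shift] at this
      push_cast at this
      exact ⟨by linarith [this.1], this.2⟩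
  induction m with
  | zero => simpa using base
  | succ m ih =>
    rcases Nat.eq_zero_or_pos m with rfl | hm
    · intro i j hij
      rw [zero_add, one_add_one_eq_two, two_nsmul] at hij
      exact ⟨bd (le_max_right _ _) (hC i j hij).1, bd (le_max_right _ _) (hC i j hij).2⟩
    · intro i j hij
      have h := coord_cocycle hf ((m + 1) • p) p i j
      rw [← succ_nsmul] at h
      have hp0 : (p : ℝ) ≠ 0 := by rintro h; simp [h] at hσ
      have hne : ((((m + 1) • p : Γ) : ℝ) : ℂ) - ((p : ℝ) : ℂ) ≠ 0 := by
        have : (m : ℝ) * p ≠ 0 := mul_ne_zero (by exact_mod_cast hm.ne') hp0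
        rw [← Complex.ofReal_sub, Complex.ofReal_ne_zero]
        convert this using 1
        push_cast
        rw [nsmul_eq_mul]
        push_cast
        ring
      have hr := mul_ne_zero hne hij
      rw [h] at hr
      by_cases h1 : coord i j (act hs ((m + 1) • p) (f (basisL s p))) = 0
      · exact step p _ hσ.le ih i j fun h2 => hr (by rw [h1, h2, sub_zero])
      · refine step ((m + 1) • p) _ ?_ base i j h1
        push_cast
        rw [nsmul_eq_mul]
        push_cast
        nlinarith [(by positivity : (0 : ℝ) ≤ m)]

end Cocycle

/-! ### Vanishing of the first cohomology -/

section Cocycle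

variable {hs : 2 * s ∈ Γ} {f : WAlg Γ s →ₗ[ℂ] WAlg Γ s ⊗[ℂ] WAlg Γ s}

/-- The coordinates of the values of `f` at the multiples of `L_n` along the family of
pairs `(i + m n, j + (l - m) n)`. -/
def famCoord (f : WAlg Γ s →ₗ[ℂ] WAlg Γ s ⊗[ℂ] WAlg Γ s) (n : Γ) (i j : Idx Γ s) (l m : ℤ) : ℂ :=
  coord (i.shift (m • n)) (j.shift ((l - m) • n)) (f (basisL s (l • n)))

theorem coord_act_shift (hs : 2 * s ∈ Γ) {n : Γ} (hn : (n : ℝ) ≠ 0) (i j : Idx Γ s)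
    (hij : i.deg + j.deg = 0) (k l m : ℤ) (v : WAlg Γ s ⊗[ℂ] WAlg Γ s) :
    coord (i.shift (m • n)) (j.shift ((k + l - m) • n)) (act hs (k • n) v) =
      ((n : ℝ) : ℂ) * ((k * i.wt - ((i.deg / n : ℝ) : ℂ) - (m - k)) *
        coord (i.shift ((m - k) • n)) (j.shift ((l - (m - k)) • n)) v +
      (k * j.wt + ((i.deg / n : ℝ) : ℂ) - (l - m)) *
        coord (i.shift (m • n)) (j.shift ((l - m) • n)) v) := by
  have hn' : ((n : ℝ) : ℂ) ≠ 0 := Complex.ofReal_ne_zero.2 hn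
  have hj : j.deg = -i.deg := by linarith
  have e1 : -(k • n) + m • n = (m - k) • n := by rw [sub_smul]; abel
  have e2 : -(k • n) + (k + l - m) • n = (l - m) • n := by
    rw [sub_smul, sub_smul, add_smul]; abel
  have e3 : l - (m - k) = k + l - m := by ring
  rw [coord_act, Idx.shift_shift, Idx.shift_shift, e1, e2, e3, Idx.coeff, Idx.coeff]
  simp only [Idx.wt_shift, Idx.deg_shift, hj, AddSubgroup.coe_zsmul, zsmul_eq_mul]
  push_cast
  field_simp
  ring

theorem famCoord_cocycle (hf : f ∈ cocycles hs) {n : Γ} (hn : (n : ℝ) ≠ 0) {i j : Idx Γ s}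
    (hij : i.deg + j.deg = 0) (k l m : ℤ) :
    ((k : ℂ) - l) * famCoord f n i j (k + l) m =
      ((k * i.wt - ((i.deg / n : ℝ) : ℂ) - (m - k)) * famCoord f n i j l (m - k) +
        (k * j.wt + ((i.deg / n : ℝ) : ℂ) - (l - m)) * famCoord f n i j l m) -
      ((l * i.wt - ((i.deg / n : ℝ) : ℂ) - (m - l)) * famCoord f n i j k (m - l) +
        (l * j.wt + ((i.deg / n : ℝ) : ℂ) - (k - m)) * famCoord f n i j k m) := by
  have hn' : ((n : ℝ) : ℂ) ≠ 0 := Complex.ofReal_ne_zero.2 hn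
  have h := coord_cocycle hf (k • n) (l • n) (i.shift (m • n)) (j.shift ((k + l - m) • n))
  rw [coord_act_shift hs hn i j hij k l m, add_comm k l, coord_act_shift hs hn i j hij l k m] at h
  simp only [AddSubgroup.coe_zsmul, zsmul_eq_mul, ← add_smul] at h
  refine mul_left_cancel₀ hn' ?_
  simp only [famCoord, add_comm k l] at h ⊢
  push_cast at h ⊢
  linear_combination h

/-- A cocycle that vanishes at `L_0` and whose values at `L_n`, `L_{-n}` and `L_{2n}` are supported
almost between degree `0` and the degree in question is, at `L_n` and `L_{2n}`, of the form
`x ↦ x ∘ u`, with `u` of degree `0` and left degrees in an interval of length `n`. -/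
theorem exists_inner_at_generators (hf : f ∈ cocycles hs) (h0 : f (basisL s 0) = 0) {n : Γ} {A : ℝ}
    (hA : 0 ≤ A) (hn : 2 * A < n)
    (b1 : ∀ i j, coord i j (f (basisL s n)) ≠ 0 → -A ≤ i.deg ∧ -A ≤ j.deg)
    (b2 : ∀ i j, coord i j (f (basisL s (n + n))) ≠ 0 → -A ≤ i.deg ∧ -A ≤ j.deg)
    (b3 : ∀ i j, coord i j (f (basisL s (-n))) ≠ 0 → i.deg ≤ A ∧ j.deg ≤ A) :
    ∃ u, f (basisL s n) = act hs n u ∧ f (basisL s (n + n)) = act hs (n + n) u := by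
  classical
  have hn0 : (0 : ℝ) < n := by linarith
  -- the degrees of the left factor range over a fundamental domain for translation by `n`
  set P : Idx Γ s → Idx Γ s → Prop := fun i j =>
    i.deg + j.deg = 0 ∧ -A ≤ i.deg ∧ i.deg < n - A with hP
  obtain ⟨u, hu⟩ := exists_coord_eq
    (fun i j => if P i j then coord i (j.shift n) (f (basisL s n)) / j.coeff n else 0)
    (((finite_coord_ne_zero (f (basisL s n))).image fun p => (p.1, p.2.shift (-n))).subset (by
      rintro ⟨i, j⟩ hij
      refine ⟨(i, j.shift n), fun h => hij ?_, by simp⟩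
      simp only at h
      simp [h]))
  -- the coordinates of `f` at the two generators, in terms of those of `u`
  have key : ∀ i j, P i j →
      coord i (j.shift n) (f (basisL s n)) = j.coeff n * coord i j u ∧
      coord (i.shift n) j (f (basisL s n)) = i.coeff n * coord i j u ∧
      coord i (j.shift (n + n)) (f (basisL s (n + n))) = j.coeff (n + n) * coord i j u ∧
      coord (i.shift n) (j.shift n) (f (basisL s (n + n))) = 0 ∧
      coord (i.shift (n + n)) j (f (basisL s (n + n))) = i.coeff (n + n) * coord i j u := by
    intro i j hij
    have hu' := hu i j
    rw [if_pos hij] at hu'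
    obtain ⟨hd, hl, hr⟩ := hij
    have hj : j.deg = -i.deg := by linarith
    -- the bounds `b1`, `b2`, `b3` leave two, three and two positions in the family
    have z1 : ∀ m : ℤ, m ≠ 0 → m ≠ 1 → famCoord f n i j 1 m = 0 := by
      intro m hm0 hm1
      by_contra h
      rw [famCoord, one_smul] at h
      have h' := b1 _ _ h
      simp only [Idx.deg_shift, AddSubgroup.coe_zsmul, zsmul_eq_mul, hj] at h'
      push_cast at h'
      rcases (by omega : m ≤ -1 ∨ 2 ≤ m) with hm | hm
      · have : (m : ℝ) ≤ -1 := by exact_mod_cast hm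
        nlinarith
      · have : (2 : ℝ) ≤ m := by exact_mod_cast hm
        nlinarith
    have z2 : ∀ m : ℤ, m ≠ 0 → m ≠ 1 → m ≠ 2 → famCoord f n i j 2 m = 0 := by
      intro m hm0 hm1 hm2
      by_contra h
      rw [famCoord, two_smul] at h
      have h' := b2 _ _ h
      simp only [Idx.deg_shift, AddSubgroup.coe_zsmul, zsmul_eq_mul, hj] at h'
      push_cast at h'
      rcases (by omega : m ≤ -1 ∨ 3 ≤ m) with hm | hm
      · have : (m : ℝ) ≤ -1 := by exact_mod_cast hm
        nlinarith
      · have : (3 : ℝ) ≤ m := by exact_mod_cast hm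
        nlinarith
    have z3 : ∀ m : ℤ, m ≠ 0 → m ≠ -1 → famCoord f n i j (-1) m = 0 := by
      intro m hm0 hm1
      by_contra h
      rw [famCoord, neg_one_smul] at h
      have h' := b3 _ _ h
      simp only [Idx.deg_shift, AddSubgroup.coe_zsmul, zsmul_eq_mul, hj] at h'
      push_cast at h'
      rcases (by omega : m ≤ -2 ∨ 1 ≤ m) with hm | hm
      · have : (m : ℝ) ≤ -2 := by exact_mod_cast hm
        nlinarith
      · have : (1 : ℝ) ≤ m := by exact_mod_cast hm
        nlinarith
    have z0 : ∀ m : ℤ, famCoord f n i j 0 m = 0 := by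
      intro m
      rw [famCoord, zero_smul, h0, map_zero]
    have E : ∀ k l m : ℤ, _ := famCoord_cocycle hf hn0.ne' hd
    have hQ : -(1 / 2) < i.deg / n := by
      rw [lt_div_iff₀ hn0]; linarith
    set Q : ℝ := i.deg / n with hQdef
    -- the coordinates of the cocycle identities for `(n, -n)` and `(-n, 2n)` along the family
    have e1 := E 1 (-1) (-1)
    have e2 := E 1 (-1) 0
    have e3 := E 1 (-1) 1
    have e4 := E (-1) 2 (-1)
    have e5 := E (-1) 2 0
    have e6 := E (-1) 2 1
    have e7 := E (-1) 2 2
    norm_num at e1 e2 e3 e4 e5 e6 e7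
    rw [z0, z3 (-2) (by norm_num) (by norm_num), z1 (-1) (by norm_num) (by norm_num)] at e1
    rw [z0] at e2
    rw [z0, z3 1 (by norm_num) (by norm_num), z1 2 (by norm_num) (by norm_num)] at e3
    rw [z1 (-1) (by norm_num) (by norm_num), z2 (-1) (by norm_num) (by norm_num) (by norm_num),
      z3 (-3) (by norm_num) (by norm_num)] at e4
    rw [z3 (-2) (by norm_num) (by norm_num)] at e5
    rw [z3 1 (by norm_num) (by norm_num)] at e6
    rw [z1 2 (by norm_num) (by norm_num), z2 3 (by norm_num) (by norm_num) (by norm_num),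
      z3 2 (by norm_num) (by norm_num)] at e7
    obtain ⟨r1, r2, r3, r4⟩ := generator_system i.wt_eq j.wt_eq hQ
      (α := famCoord f n i j 1 0) (β := famCoord f n i j 1 1) (γ := famCoord f n i j (-1) (-1))
      (δ := famCoord f n i j (-1) 0) (x := famCoord f n i j 2 0) (y := famCoord f n i j 2 1)
      (z := famCoord f n i j 2 2)
      (by linear_combination -e1) (by linear_combination -e2) (by linear_combination -e3)
      (by linear_combination -e4) (by linear_combination e5) (by linear_combination e6)
      (by linear_combination -e7)
    have hnC : ((n : ℝ) : ℂ) ≠ 0 := Complex.ofReal_ne_zero.2 hn0.ne'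
    have hQn : ((i.deg : ℝ) : ℂ) = Q * ((n : ℝ) : ℂ) := by
      rw [hQdef]; push_cast; field_simp
    have cj : ∀ m : ℤ, j.coeff (m • n) = ((n : ℝ) : ℂ) * (m * j.wt + Q) := by
      intro m
      rw [Idx.coeff, hj, AddSubgroup.coe_zsmul, zsmul_eq_mul]
      push_cast
      rw [hQn]
      ring
    have ci : ∀ m : ℤ, i.coeff (m • n) = ((n : ℝ) : ℂ) * (m * i.wt - Q) := by
      intro m
      rw [Idx.coeff, AddSubgroup.coe_zsmul, zsmul_eq_mul]
      push_cast
      rw [hQn]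
      ring
    have cj1 := cj 1
    have cj2 := cj 2
    have ci1 := ci 1
    have ci2 := ci 2
    have nz : ((j.wt : ℝ) : ℂ) + Q ≠ 0 := by
      have := j.half_le_wt
      exact_mod_cast (by linarith : (0 : ℝ) < j.wt + Q).ne'
    norm_num [two_smul] at cj1 cj2 ci1 ci2
    norm_num [famCoord, two_smul] at r1 r2 r3 r4
    rw [hu', cj1, cj2, ci1, ci2, r1, r2, r3, r4]
    refine ⟨?_, ?_, ?_, rfl, ?_⟩ <;> field_simp
  have supp : ∀ i j, ¬ P i j → coord i j u = 0 := fun i j h => by rw [hu, if_neg h]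
  -- each pair of basis vectors lies in the family of at most one pair satisfying `P`; pairs in no
  -- such position are excluded by the degree and the bounds on the support
  refine ⟨u, coord_ext fun i j => ?_, coord_ext fun i j => ?_⟩
  · rw [coord_act]
    by_cases c1 : P i (j.shift (-n))
    · rw [supp (i.shift (-n)) j, mul_zero, zero_add, ← (key _ _ c1).1, Idx.shift_shift_neg]
      intro c2
      have := c2.2.1
      rw [Idx.deg_shift] at this
      push_cast at this
      linarith [c1.2.2]
    · rw [supp _ _ c1, mul_zero, add_zero]
      by_cases c2 : P (i.shift (-n)) j
      · rw [← (key _ _ c2).2.1, Idx.shift_shift_neg]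
      · rw [supp _ _ c2, mul_zero]
        by_contra h
        have hd := deg_of_coord_ne_zero hf h0 h
        have hb := b1 _ _ h
        simp only [hP, Idx.deg_shift, not_and, not_lt] at c1 c2
        push_cast at c1 c2
        have h1 := c1 (by linarith) hb.1
        have h2 := c2 (by linarith) (by linarith)
        linarith
  · rw [coord_act]
    by_cases c1 : P i (j.shift (-(n + n)))
    · rw [supp (i.shift (-(n + n))) j, mul_zero, zero_add, ← (key _ _ c1).2.2.1,
        Idx.shift_shift_neg]
      intro c2
      have := c2.2.1
      rw [Idx.deg_shift] at this
      push_cast at this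
      linarith [c1.2.2]
    · rw [supp _ _ c1, mul_zero, add_zero]
      by_cases c2 : P (i.shift (-(n + n))) j
      · rw [← (key _ _ c2).2.2.2.2, Idx.shift_shift_neg]
      · rw [supp _ _ c2, mul_zero]
        by_cases c3 : P (i.shift (-n)) (j.shift (-n))
        · rw [← (key _ _ c3).2.2.2.1, Idx.shift_shift_neg, Idx.shift_shift_neg]
        · by_contra h
          have hd := deg_of_coord_ne_zero hf h0 h
          have hb := b2 _ _ h
          simp only [hP, Idx.deg_shift, not_and, not_lt] at c1 c2 c3
          push_cast at c1 c2 c3 hd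
          have h1 := c1 (by linarith) hb.1
          have h3 := c3 (by linarith) (by linarith)
          have h2 := c2 (by linarith) (by linarith)
          linarith

/-- Every `1`-cocycle of `WAlg` with values in `WAlg ⊗ WAlg` is a coboundary. -/
theorem cocycles_le_range_innMap (hΓ : Γ ≠ ⊥) (hs : 2 * s ∈ Γ) :
    cocycles hs ≤ LinearMap.range (innMap (adjTensor (bracket hs))) := by
  intro f hf
  obtain ⟨g, hg, u, rfl, h0⟩ := exists_inner_at_zero hΓ hf
  refine add_mem ?_ ⟨u, rfl⟩
  obtain ⟨p, hp⟩ := exists_large hΓ 0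
  obtain ⟨A, hA⟩ := exists_uniform_bound hg (p := p) (σ := 1) (by linarith)
  obtain ⟨B, hB⟩ := exists_uniform_bound hg (p := -p) (σ := -1) (by push_cast; linarith)
  obtain ⟨m, hm⟩ := exists_nat_gt (2 * max 0 (max A B) / p)
  rw [div_lt_iff₀ hp] at hm
  have hA' : A ≤ max 0 (max A B) := (le_max_left _ _).trans (le_max_right _ _)
  have hB' : B ≤ max 0 (max A B) := (le_max_right _ _).trans (le_max_right _ _)
  have hn : 2 * max 0 (max A B) < (((m + 1) • p : Γ) : ℝ) := by
    push_cast; rw [nsmul_eq_mul]; push_cast; linarith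
  obtain ⟨v, hv1, hv2⟩ := exists_inner_at_generators hg h0 (le_max_left _ _) hn
    (fun i j h => by
      have := hA m i j h
      constructor <;> linarith [this.1, this.2])
    (fun i j h => by
      rw [← add_nsmul, show m + 1 + (m + 1) = (m + 1 + m) + 1 by ring] at h
      have := hA _ i j h
      constructor <;> linarith [this.1, this.2])
    (fun i j h => by
      rw [← smul_neg] at h
      have := hB m i j h
      constructor <;> linarith [this.1, this.2])
  obtain ⟨e, he, rfl⟩ := exists_sub_innMap hg v
  rw [LinearMap.add_apply, innMap_basisL] at hv1 hv2
  have hpos : 0 < (((m + 1) • p : Γ) : ℝ) := by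
    linarith [le_max_left 0 (max A B)]
  have hz : ∀ x y : WAlg Γ s ⊗[ℂ] WAlg Γ s, x + y = y → x = 0 := fun x y h =>
    coord_ext fun i j => by
      have h' := congrArg (coord i j) h
      rw [map_add] at h'
      rw [map_zero]
      linear_combination h'
  rw [cocycle_eq_zero_of_generators he hpos (hz _ _ hv1) (hz _ _ hv2), zero_add]
  exact ⟨v, rfl⟩

end Cocycle

/-! ### The co-Jacobi identity and the classical Yang-Baxter equation -/

section YangBaxter

variable {L : Type*} [AddCommGroup L] [Module ℂ L] [SuperSpace L]

theorem superTwist_tmul {i j : ZMod 2} {a b : L} (ha : a ∈ part L i) (hb : b ∈ part L j) :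
    superTwist L (a ⊗ₜ[ℂ] b) = sgn i j • b ⊗ₜ[ℂ] a := by
  simp only [superTwist, sum_zmod_two, LinearMap.add_apply, LinearMap.smul_apply,
    LinearMap.comp_apply, TensorProduct.map_tmul, proj_of_mem ha, proj_of_mem hb]
  rcases zmod_two_cases i with rfl | rfl <;> rcases zmod_two_cases j with rfl | rfl <;> simp

theorem superTwist_superTwist (v : L ⊗[ℂ] L) : superTwist L (superTwist L v) = v := by
  have key : ∀ i j, ∀ a ∈ part L i, ∀ b ∈ part L j,
      superTwist L (superTwist L (a ⊗ₜ[ℂ] b)) = a ⊗ₜ[ℂ] b := by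
    intro i j a ha b hb
    rw [superTwist_tmul ha hb, map_smul, superTwist_tmul hb ha, smul_smul, sgn_comm j i,
      sgn_mul_self, one_smul]
  induction v with
  | zero => simp
  | add v w hv hw => rw [map_add, map_add, hv, hw]
  | tmul a b =>
    rw [← SuperSpace.proj_add a, ← SuperSpace.proj_add b]
    simp only [TensorProduct.add_tmul, TensorProduct.tmul_add, map_add,
      key _ _ _ (proj_mem _ a) _ (proj_mem _ b)]

theorem superTwist_adjTensor {φ : L →ₗ[ℂ] L →ₗ[ℂ] L}
    (hφ : ∀ i j : ZMod 2, ∀ x ∈ part L i, ∀ y ∈ part L j, φ x y ∈ part L (i + j))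
    {x : L} (hx : x ∈ part L 0) (v : L ⊗[ℂ] L) :
    superTwist L (adjTensor φ x v) = adjTensor φ x (superTwist L v) := by
  have hm : ∀ {j : ZMod 2} {y : L}, y ∈ part L j → φ x y ∈ part L j := fun {j y} hy => by
    simpa using hφ 0 j x hx y hy
  have key : ∀ i j, ∀ a ∈ part L i, ∀ b ∈ part L j,
      superTwist L (adjTensor φ x (a ⊗ₜ[ℂ] b)) = adjTensor φ x (superTwist L (a ⊗ₜ[ℂ] b)) := by
    intro i j a ha b hb
    rw [adjTensor_tmul φ hx ha, superTwist_tmul ha hb, map_add, map_smul, map_smul,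
      superTwist_tmul (hm ha) hb, superTwist_tmul ha (hm hb), adjTensor_tmul φ hx hb,
      sgn_zero_left, sgn_zero_left, one_smul, one_smul, smul_add, add_comm]
  induction v with
  | zero => simp
  | add v w hv hw => rw [map_add, map_add, hv, hw, map_add, map_add]
  | tmul a b =>
    rw [← SuperSpace.proj_add a, ← SuperSpace.proj_add b]
    simp only [TensorProduct.add_tmul, TensorProduct.tmul_add, map_add,
      key _ _ _ (proj_mem _ a) _ (proj_mem _ b)]

theorem add_superTwist_of_mem_range {v : L ⊗[ℂ] L}
    (hv : v ∈ LinearMap.range (LinearMap.id - superTwist L)) : v + superTwist L v = 0 := by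
  obtain ⟨w, rfl⟩ := hv
  simp only [LinearMap.sub_apply, LinearMap.id_apply, map_sub, superTwist_superTwist]
  abel

theorem sub_superTwist_of_add_eq_zero {v : L ⊗[ℂ] L} (hv : v + superTwist L v = 0) :
    v - superTwist L v = (2 : ℂ) • v := by
  rw [eq_neg_of_add_eq_zero_right hv, two_smul, sub_neg_eq_add]

theorem superCyclic_tmul {i j k : ZMod 2} {a b c : L} (ha : a ∈ part L i) (hb : b ∈ part L j)
    (hc : c ∈ part L k) : superCyclic L (a ⊗ₜ[ℂ] (b ⊗ₜ[ℂ] c)) =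
      (sgn i j * sgn i k) • b ⊗ₜ[ℂ] (c ⊗ₜ[ℂ] a) := by
  simp only [superCyclic, LinearMap.comp_apply, LinearEquiv.coe_coe,
    TensorProduct.assoc_symm_tmul, LinearMap.rTensor_tmul, superTwist_tmul ha hb]
  rw [← TensorProduct.smul_tmul', map_smul, map_smul, TensorProduct.assoc_tmul,
    LinearMap.lTensor_tmul, superTwist_tmul ha hc, TensorProduct.tmul_smul, smul_smul]

theorem cyclicSum_tmul {i j k : ZMod 2} {a b c : L} (ha : a ∈ part L i) (hb : b ∈ part L j)
    (hc : c ∈ part L k) : cyclicSum L (a ⊗ₜ[ℂ] (b ⊗ₜ[ℂ] c)) =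
      a ⊗ₜ[ℂ] (b ⊗ₜ[ℂ] c) + (sgn i j * sgn i k) • b ⊗ₜ[ℂ] (c ⊗ₜ[ℂ] a) +
        (sgn i k * sgn j k) • c ⊗ₜ[ℂ] (a ⊗ₜ[ℂ] b) := by
  simp only [cyclicSum, LinearMap.add_apply, LinearMap.id_apply, LinearMap.comp_apply,
    superCyclic_tmul ha hb hc, map_smul, superCyclic_tmul hb hc ha, smul_smul]
  congr 2
  rw [sgn_comm j i]
  linear_combination (sgn i k * sgn j k) * sgn_mul_self i j

theorem superMiddle_tmul {j k : ZMod 2} (a : L) {b c : L} (d : L) (hb : b ∈ part L j)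
    (hc : c ∈ part L k) : superMiddle L ((a ⊗ₜ[ℂ] b) ⊗ₜ[ℂ] (c ⊗ₜ[ℂ] d)) =
      sgn j k • (a ⊗ₜ[ℂ] c) ⊗ₜ[ℂ] (b ⊗ₜ[ℂ] d) := by
  simp only [superMiddle, sum_zmod_two, LinearMap.add_apply, LinearMap.smul_apply,
    LinearMap.comp_apply, TensorProduct.map_tmul, LinearMap.lTensor_tmul, LinearMap.rTensor_tmul,
    proj_of_mem hb, proj_of_mem hc]
  rcases zmod_two_cases j with rfl | rfl <;> rcases zmod_two_cases k with rfl | rfl <;> simp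

/-- The bilinear map whose diagonal is `r ↦ (1 + ξ + ξ²)(1 ⊗ Δ)Δ(x)`, where `Δ(y) = y ∘ r`. -/
def coJacobi (φ : L →ₗ[ℂ] L →ₗ[ℂ] L) (x : L) :
    L ⊗[ℂ] L →ₗ[ℂ] L ⊗[ℂ] L →ₗ[ℂ] L ⊗[ℂ] (L ⊗[ℂ] L) :=
  LinearMap.mk₂ ℂ (fun r t => cyclicSum L (((adjTensor φ).flip t).lTensor L (adjTensor φ x r)))
    (fun r r' t => by simp only [map_add]) (fun c r t => by simp only [map_smul])
    (fun r t t' => by simp only [map_add, LinearMap.lTensor_add, LinearMap.add_apply])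
    (fun c r t => by simp only [map_smul, LinearMap.lTensor_smul, LinearMap.smul_apply])

/-- The bilinear map whose diagonal is `r ↦ c(r)`. -/
def cybeBilin (φ : L →ₗ[ℂ] L →ₗ[ℂ] L) :
    L ⊗[ℂ] L →ₗ[ℂ] L ⊗[ℂ] L →ₗ[ℂ] L ⊗[ℂ] (L ⊗[ℂ] L) :=
  TensorProduct.curry
    ((TensorProduct.lift φ).rTensor (L ⊗[ℂ] L) ∘ₗ superMiddle L +
      ((TensorProduct.lift φ).rTensor L ∘ₗ
        (TensorProduct.assoc ℂ L L L).symm.toLinearMap).lTensor L ∘ₗ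
          (TensorProduct.assoc ℂ L L (L ⊗[ℂ] L)).toLinearMap +
      (TensorProduct.assoc ℂ L L L).toLinearMap ∘ₗ
        (TensorProduct.lift φ).lTensor (L ⊗[ℂ] L) ∘ₗ superMiddle L)

theorem cybe_eq_cybeBilin (φ : L →ₗ[ℂ] L →ₗ[ℂ] L) (r : L ⊗[ℂ] L) :
    cybe φ r = cybeBilin φ r r := rfl

/-- The diagonal action of an even element on `L ⊗ L ⊗ L`. -/
def tripleAct (φ : L →ₗ[ℂ] L →ₗ[ℂ] L) (x : L) :
    L ⊗[ℂ] (L ⊗[ℂ] L) →ₗ[ℂ] L ⊗[ℂ] (L ⊗[ℂ] L) :=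
  (φ x).rTensor (L ⊗[ℂ] L) + (adjTensor φ x).lTensor L

theorem tripleAct_tmul (φ : L →ₗ[ℂ] L →ₗ[ℂ] L) {x : L} (hx : x ∈ part L 0) (a b c : L) :
    tripleAct φ x (a ⊗ₜ[ℂ] (b ⊗ₜ[ℂ] c)) = φ x a ⊗ₜ[ℂ] (b ⊗ₜ[ℂ] c) +
      a ⊗ₜ[ℂ] (φ x b ⊗ₜ[ℂ] c) + a ⊗ₜ[ℂ] (b ⊗ₜ[ℂ] φ x c) := by
  simp [tripleAct, adjTensor_even φ hx, add_assoc]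

theorem cybeBilin_tmul (φ : L →ₗ[ℂ] L →ₗ[ℂ] L) {j k : ZMod 2} (a : L) {b c : L} (d : L)
    (hb : b ∈ part L j) (hc : c ∈ part L k) :
    cybeBilin φ (a ⊗ₜ[ℂ] b) (c ⊗ₜ[ℂ] d) = sgn j k • φ a c ⊗ₜ[ℂ] (b ⊗ₜ[ℂ] d) +
      a ⊗ₜ[ℂ] (φ b c ⊗ₜ[ℂ] d) + sgn j k • a ⊗ₜ[ℂ] (c ⊗ₜ[ℂ] φ b d) := by
  simp only [cybeBilin, TensorProduct.curry_apply, LinearMap.add_apply, LinearMap.comp_apply,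
    superMiddle_tmul a d hb hc, map_smul]
  simp

variable {φ : L →ₗ[ℂ] L →ₗ[ℂ] L}

/-- The hypotheses cover the summands of an even tensor, whose two factors have equal parity. -/
theorem coJacobi_tmul
    (hφ : ∀ i j : ZMod 2, ∀ x ∈ part L i, ∀ y ∈ part L j, φ x y ∈ part L (i + j))
    {x : L} (hx : x ∈ part L 0) {i k : ZMod 2} {a b c d : L} (ha : a ∈ part L i)
    (hb : b ∈ part L i) (hc : c ∈ part L k) (hd : d ∈ part L k) :
    coJacobi φ x (a ⊗ₜ[ℂ] b) (c ⊗ₜ[ℂ] d) =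
      (φ x a ⊗ₜ[ℂ] (φ b c ⊗ₜ[ℂ] d) + sgn i i • φ b c ⊗ₜ[ℂ] (d ⊗ₜ[ℂ] φ x a) +
        sgn k k • d ⊗ₜ[ℂ] (φ x a ⊗ₜ[ℂ] φ b c) + sgn i k • φ x a ⊗ₜ[ℂ] (c ⊗ₜ[ℂ] φ b d) +
        (sgn i k * sgn i i) • c ⊗ₜ[ℂ] (φ b d ⊗ₜ[ℂ] φ x a) +
        (sgn i k * sgn i i * sgn k k) • φ b d ⊗ₜ[ℂ] (φ x a ⊗ₜ[ℂ] c)) +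
      (a ⊗ₜ[ℂ] (φ (φ x b) c ⊗ₜ[ℂ] d) + sgn i i • φ (φ x b) c ⊗ₜ[ℂ] (d ⊗ₜ[ℂ] a) +
        sgn k k • d ⊗ₜ[ℂ] (a ⊗ₜ[ℂ] φ (φ x b) c) + sgn i k • a ⊗ₜ[ℂ] (c ⊗ₜ[ℂ] φ (φ x b) d) +
        (sgn i k * sgn i i) • c ⊗ₜ[ℂ] (φ (φ x b) d ⊗ₜ[ℂ] a) +
        (sgn i k * sgn i i * sgn k k) • φ (φ x b) d ⊗ₜ[ℂ] (a ⊗ₜ[ℂ] c)) := by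
  have key : ∀ u ∈ part L i, ∀ v ∈ part L i,
      cyclicSum L (u ⊗ₜ[ℂ] adjTensor φ v (c ⊗ₜ[ℂ] d)) =
      u ⊗ₜ[ℂ] (φ v c ⊗ₜ[ℂ] d) + sgn i i • φ v c ⊗ₜ[ℂ] (d ⊗ₜ[ℂ] u) +
        sgn k k • d ⊗ₜ[ℂ] (u ⊗ₜ[ℂ] φ v c) + sgn i k • u ⊗ₜ[ℂ] (c ⊗ₜ[ℂ] φ v d) +
        (sgn i k * sgn i i) • c ⊗ₜ[ℂ] (φ v d ⊗ₜ[ℂ] u) +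
        (sgn i k * sgn i i * sgn k k) • φ v d ⊗ₜ[ℂ] (u ⊗ₜ[ℂ] c) := by
    intro u hu v hv
    rw [adjTensor_tmul φ hv hc, TensorProduct.tmul_add, TensorProduct.tmul_smul, map_add,
      map_smul, cyclicSum_tmul hu (hφ i k v hv c hc) hd, cyclicSum_tmul hu hc (hφ i k v hv d hd)]
    rcases zmod_two_cases i with rfl | rfl <;> rcases zmod_two_cases k with rfl | rfl <;>
      simp only [sgn_zero_left, sgn_zero_right, sgn_one_one, add_zero, zero_add,
        show (1 + 1 : ZMod 2) = 0 from rfl] <;> module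
  have hm : ∀ {y : L}, y ∈ part L i → φ x y ∈ part L i := fun {y} hy => by
    simpa using hφ 0 i x hx y hy
  change cyclicSum L (((adjTensor φ).flip (c ⊗ₜ[ℂ] d)).lTensor L (adjTensor φ x (a ⊗ₜ[ℂ] b))) = _
  rw [adjTensor_tmul φ hx ha, sgn_zero_left, one_smul, map_add, map_add, LinearMap.lTensor_tmul,
    LinearMap.lTensor_tmul, LinearMap.flip_apply, LinearMap.flip_apply, key _ (hm ha) _ hb,
    key _ ha _ (hm hb)]

/-- For an even skew-symmetric `r`, the co-Jacobi expression of `Δ(y) = y ∘ r` at an even `x` is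
`x ∘ c(r)`, in polarised form and on decomposable tensors. -/
theorem coJacobi_skew_tmul
    (hφ : ∀ i j : ZMod 2, ∀ x ∈ part L i, ∀ y ∈ part L j, φ x y ∈ part L (i + j))
    (hS : ∀ i j : ZMod 2, ∀ x ∈ part L i, ∀ y ∈ part L j, φ y x = -(sgn i j • φ x y))
    (hJ : ∀ i j : ZMod 2, ∀ x ∈ part L i, ∀ y ∈ part L j, ∀ z,
      φ (φ x y) z = φ x (φ y z) - sgn i j • φ y (φ x z))
    {x : L} (hx : x ∈ part L 0) {i k : ZMod 2} {a b c d : L} (ha : a ∈ part L i)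
    (hb : b ∈ part L i) (hc : c ∈ part L k) (hd : d ∈ part L k) :
    coJacobi φ x (a ⊗ₜ[ℂ] b - superTwist L (a ⊗ₜ[ℂ] b)) (c ⊗ₜ[ℂ] d - superTwist L (c ⊗ₜ[ℂ] d)) +
      coJacobi φ x (c ⊗ₜ[ℂ] d - superTwist L (c ⊗ₜ[ℂ] d)) (a ⊗ₜ[ℂ] b - superTwist L (a ⊗ₜ[ℂ] b)) =
    tripleAct φ x
      (cybeBilin φ (a ⊗ₜ[ℂ] b - superTwist L (a ⊗ₜ[ℂ] b)) (c ⊗ₜ[ℂ] d - superTwist L (c ⊗ₜ[ℂ] d)) +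
        cybeBilin φ (c ⊗ₜ[ℂ] d - superTwist L (c ⊗ₜ[ℂ] d))
          (a ⊗ₜ[ℂ] b - superTwist L (a ⊗ₜ[ℂ] b))) := by
  have hm : ∀ {j : ZMod 2} {y : L}, y ∈ part L j → φ x y ∈ part L j := fun {j y} hy => by
    simpa using hφ 0 j x hx y hy
  -- all brackets are expressed through `[u, w]`, `[[x, u], w]`, `[u, [x, w]]` with `u ∈ {a, b}`
  -- and `w ∈ {c, d}`
  have hx2 : ∀ u ∈ part L i, ∀ w, φ x (φ u w) = φ (φ x u) w + φ u (φ x w) := by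
    intro u hu w
    rw [hJ 0 i x hx u hu w, sgn_zero_left, one_smul, sub_add_cancel]
  rw [superTwist_tmul ha hb, superTwist_tmul hc hd]
  simp only [map_sub, map_smul, LinearMap.sub_apply, LinearMap.smul_apply,
    coJacobi_tmul hφ hx ha hb hc hd, coJacobi_tmul hφ hx hb ha hc hd,
    coJacobi_tmul hφ hx ha hb hd hc, coJacobi_tmul hφ hx hb ha hd hc,
    coJacobi_tmul hφ hx hc hd ha hb, coJacobi_tmul hφ hx hd hc ha hb,
    coJacobi_tmul hφ hx hc hd hb ha, coJacobi_tmul hφ hx hd hc hb ha,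
    cybeBilin_tmul φ a d hb hc, cybeBilin_tmul φ b d ha hc, cybeBilin_tmul φ a c hb hd,
    cybeBilin_tmul φ b c ha hd, cybeBilin_tmul φ c b hd ha, cybeBilin_tmul φ d b hc ha,
    cybeBilin_tmul φ c a hd hb, cybeBilin_tmul φ d a hc hb, map_add, tripleAct_tmul φ hx]
  simp only [hS i k a ha c hc, hS i k a ha d hd, hS i k b hb c hc, hS i k b hb d hd,
    hS i k a ha _ (hm hc), hS i k a ha _ (hm hd), hS i k b hb _ (hm hc), hS i k b hb _ (hm hd),
    map_neg, map_smul, hx2 a ha, hx2 b hb]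
  rcases zmod_two_cases i with rfl | rfl <;> rcases zmod_two_cases k with rfl | rfl <;>
    simp only [sgn_zero_left, sgn_zero_right, sgn_one_one, one_smul, neg_smul, mul_one, neg_neg,
      mul_neg, TensorProduct.add_tmul, TensorProduct.tmul_add, TensorProduct.neg_tmul,
      TensorProduct.tmul_neg] <;>
    abel

/-- For an even skew-symmetric `r`, `(1 + ξ + ξ²)(1 ⊗ Δ)Δ(x) = x ∘ c(r)` for even `x`. As
`(1 - τ) r = 2 r`, this is the diagonal of the polarised identity, which is bilinear. -/
theorem coJacobi_eq_tripleAct_cybe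
    (hφ : ∀ i j : ZMod 2, ∀ x ∈ part L i, ∀ y ∈ part L j, φ x y ∈ part L (i + j))
    (hS : ∀ i j : ZMod 2, ∀ x ∈ part L i, ∀ y ∈ part L j, φ y x = -(sgn i j • φ x y))
    (hJ : ∀ i j : ZMod 2, ∀ x ∈ part L i, ∀ y ∈ part L j, ∀ z,
      φ (φ x y) z = φ x (φ y z) - sgn i j • φ y (φ x z))
    {x : L} (hx : x ∈ part L 0) {r : L ⊗[ℂ] L} (hr : r ∈ part (L ⊗[ℂ] L) 0)
    (hr' : r + superTwist L r = 0) : coJacobi φ x r r = tripleAct φ x (cybe φ r) := by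
  have h2 : ∀ {i j : ZMod 2}, i + j = 0 → j = i := by decide
  have key : ∀ q ∈ part (L ⊗[ℂ] L) 0, ∀ t ∈ part (L ⊗[ℂ] L) 0,
      coJacobi φ x (q - superTwist L q) (t - superTwist L t) +
        coJacobi φ x (t - superTwist L t) (q - superTwist L q) =
      tripleAct φ x (cybeBilin φ (q - superTwist L q) (t - superTwist L t) +
        cybeBilin φ (t - superTwist L t) (q - superTwist L q)) := by
    intro q hq t ht
    replace hq := exists_homogeneous_of_mem_part hq
    replace ht := exists_homogeneous_of_mem_part ht
    induction hq using Submodule.span_induction with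
    | zero => simp
    | add q q' _ _ h h' =>
      simp only [map_add, map_sub, LinearMap.add_apply, LinearMap.sub_apply] at h h' ⊢
      refine Eq.trans ?_ ((congrArg₂ (· + ·) h h').trans ?_) <;> abel
    | smul c q _ h =>
      simp only [map_add, map_sub, LinearMap.sub_apply, map_smul, LinearMap.smul_apply] at h ⊢
      refine Eq.trans ?_ ((congrArg (c • ·) h).trans ?_) <;> module
    | mem q hq =>
      obtain ⟨i, j, hij, a, ha, b, hb, rfl⟩ := hq
      obtain rfl := h2 hij
      induction ht using Submodule.span_induction with
      | zero => simp
      | add q q' _ _ h h' =>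
        simp only [map_add, map_sub, LinearMap.add_apply, LinearMap.sub_apply] at h h' ⊢
        refine Eq.trans ?_ ((congrArg₂ (· + ·) h h').trans ?_) <;> abel
      | smul c q _ h =>
        simp only [map_add, map_sub, LinearMap.sub_apply, map_smul, LinearMap.smul_apply] at h ⊢
        refine Eq.trans ?_ ((congrArg (c • ·) h).trans ?_) <;> module
      | mem t ht =>
        obtain ⟨k, l, hkl, c, hc, d, hd, rfl⟩ := ht
        obtain rfl := h2 hkl
        exact coJacobi_skew_tmul hφ hS hJ hx ha hb hc hd
  have h := key r hr r hr
  rw [sub_superTwist_of_add_eq_zero hr'] at h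
  simp only [map_smul, LinearMap.smul_apply, ← two_smul ℂ, smul_smul] at h
  rw [cybe_eq_cybeBilin]
  exact smul_right_injective _ (by norm_num : (2 * (2 * 2) : ℂ) ≠ 0) h

/-- A Lie super-bialgebra structure is an even derivation. -/
theorem IsLieSuperbialgebra.mem_derPart {Δ : L →ₗ[ℂ] L ⊗[ℂ] L} (h : IsLieSuperbialgebra φ Δ) :
    Δ ∈ derPart φ (adjTensor φ) 0 := by
  refine ⟨fun i x hx => by simpa using h.coalgebra.graded i x hx, fun i j x hx y hy => ?_⟩
  rw [h.compat i j x hx y hy, sgn_zero_left, one_smul, zero_add, sgn_comm]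

/-- If the elements of `L ⊗ L` and `L ⊗ L ⊗ L` that are killed by all even elements vanish, then an
inner Lie super-bialgebra structure is triangular: `r + τ r` and `c(r)` are such elements. -/
theorem IsLieSuperbialgebra.isTriangularCoboundary {Δ : L →ₗ[ℂ] L ⊗[ℂ] L}
    (h : IsLieSuperbialgebra φ Δ)
    (hφ : ∀ i j : ZMod 2, ∀ x ∈ part L i, ∀ y ∈ part L j, φ x y ∈ part L (i + j))
    (hS : ∀ i j : ZMod 2, ∀ x ∈ part L i, ∀ y ∈ part L j, φ y x = -(sgn i j • φ x y))
    (hJ : ∀ i j : ZMod 2, ∀ x ∈ part L i, ∀ y ∈ part L j, ∀ z,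
      φ (φ x y) z = φ x (φ y z) - sgn i j • φ y (φ x z))
    (hΔ : Δ ∈ LinearMap.range (innMap (adjTensor φ)))
    (inv2 : ∀ v : L ⊗[ℂ] L, (∀ x ∈ part L 0, adjTensor φ x v = 0) → v = 0)
    (inv3 : ∀ v : L ⊗[ℂ] (L ⊗[ℂ] L), (∀ x ∈ part L 0, tripleAct φ x v = 0) → v = 0) :
    IsTriangularCoboundary φ Δ := by
  obtain ⟨a, ha⟩ := hΔ
  have hr : Δ = innMap (adjTensor φ) (proj 0 a) := by
    rw [← parityComponent_innMap (adjTensor_mem_part hφ), ha,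
      parityComponent_of_mem_derPart h.mem_derPart]
  clear ha
  have hre := proj_mem 0 a
  generalize proj 0 a = r at hr hre
  have hΔr : Δ = (adjTensor φ).flip r := linearMap_ext_part fun i x hx => by
    rw [hr, innMap_apply_of_mem _ hre hx, sgn_zero_left, one_smul, LinearMap.flip_apply]
  have hskew : r + superTwist L r = 0 := inv2 _ fun x hx => by
    rw [map_add, ← superTwist_adjTensor hφ hx]
    refine add_superTwist_of_mem_range (h.coalgebra.skew ⟨x, ?_⟩)
    rw [hΔr, LinearMap.flip_apply]
  refine ⟨h, r, ⟨(1 / 2 : ℂ) • r, ?_⟩, hre, hr, inv3 _ fun x hx => ?_⟩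
  · rw [map_smul, LinearMap.sub_apply, LinearMap.id_apply, sub_superTwist_of_add_eq_zero hskew,
      smul_smul]
    norm_num
  · rw [← coJacobi_eq_tripleAct_cybe hφ hS hJ hx hre hskew]
    have := LinearMap.congr_fun h.coalgebra.jacobi x
    rw [hΔr] at this
    exact this

end YangBaxter

theorem bracket_skew (hs : 2 * s ∈ Γ) (i j : ZMod 2) (x : WAlg Γ s)
    (hx : x ∈ part (WAlg Γ s) i) (y : WAlg Γ s) (hy : y ∈ part (WAlg Γ s) j) :
    bracket hs y x = -(sgn i j • bracket hs x y) := by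
  refine part_induction (P := fun x => bracket hs y x = -(sgn i j • bracket hs x y)) ?_ ?_ ?_ hx
  · simp
  · intro x x' h h'; simp only [map_add, LinearMap.add_apply, h, h', smul_add]; abel
  · rintro a c rfl
    refine part_induction (P := fun y => bracket hs y _ = -(sgn _ j • bracket hs _ y)) ?_ ?_ ?_ hy
    · simp
    · intro x x' h h'; simp only [map_add, LinearMap.add_apply, h, h', smul_add]; abel
    · rintro b d rfl
      have h : basisBracket hs b a = -(sgn a.parity b.parity • basisBracket hs a b) := by
        cases a <;> cases b <;>
          simp only [basisBracket, Idx.parity, sgn_zero_left, sgn_zero_right, sgn_one_one,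
            one_smul, neg_smul, smul_zero, neg_zero, neg_neg, add_comm]
        -- only `[L_q, L_p] = -[L_p, L_q]` is left, that is `q - p = -(p - q)`
        simp only [← Finsupp.single_neg]
        congr 1
        ring
      rw [bracket_single, bracket_single, h, mul_comm d c]
      module

end SuperW

end

theorem mainTheorem1 (Γ : AddSubgroup ℝ) (hΓ : Γ ≠ ⊥) (s : ℝ) (hs : 2 * s ∈ Γ) :
    (Subsingleton (SuperW.H1 (SuperW.bracket hs) (SuperW.adjTensor (SuperW.bracket hs))) ∧
      SuperW.der (SuperW.bracket hs) (SuperW.adjTensor (SuperW.bracket hs)) =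
        SuperW.inn (SuperW.adjTensor (SuperW.bracket hs))) ∧
    ∀ Δ : SuperW.WAlg Γ s →ₗ[ℂ] TensorProduct ℂ (SuperW.WAlg Γ s) (SuperW.WAlg Γ s),
      SuperW.IsLieSuperbialgebra (SuperW.bracket hs) Δ →
        SuperW.IsTriangularCoboundary (SuperW.bracket hs) Δ := by
  have hgr := SuperW.bracket_graded hs
  have hJ := SuperW.bracket_jacobi hs
  have hH := SuperW.cocycles_le_range_innMap hΓ hs
  refine ⟨SuperW.subsingleton_H1_and_der_eq_inn hgr (SuperW.adjTensor_mem_part hgr)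
    (SuperW.adjTensor_bracket hgr hJ) hH, fun Δ hΔ => ?_⟩
  refine hΔ.isTriangularCoboundary hgr (SuperW.bracket_skew hs) hJ
    (hH (SuperW.derPart_le_ker_cobdry _ _ 0 hΔ.mem_derPart)) (fun v hv => ?_) fun v hv => ?_
  · obtain ⟨K, hK⟩ := SuperW.eq_zero_of_act_eq_zero hs v
    obtain ⟨k, hk⟩ := SuperW.exists_large hΓ K
    exact hK k hk (hv _ (SuperW.basisL_mem k))
  · obtain ⟨K, hK⟩ := SuperW.eq_zero_of_large
      (M := TensorProduct ℂ (SuperW.WAlg Γ s) (SuperW.WAlg Γ s)) hs v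
    obtain ⟨k, hk⟩ := SuperW.exists_large hΓ K
    exact hK k hk _ (hv _ (SuperW.basisL_mem k))
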